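/- **Theorem.** Let $X_1,X_2,W,R$ be real, reflexive, separable Banach spaces and let $(\Omega,\mathcal F,\mathbb P)$ be a complete probability space. *Assumption 1.* $C_1\subset X_1$ and $C_2\subset X_2$ are nonempty, closed and convex, and $K\subset R$ is a nonempty closed convex cone (write $r\le_K s$ if $s-r\in K$). The functions $J_1:X_1\to\mathbb R$ and $J_2:X_1\times X_2\to\mathbb R$ are such that $(x_1,x_2)\mapsto J_1(x_1)+J_2(x_1,x_2)$ is convex, and for every $r>0$ there is $a_r>0$ with $|J_2(x_1,x_2)|\le a_r$ whenever $\|x_1\|+\|x_2\|\le r$. The maps $e:X_1\times X_2\times\Omega\to W$ and $i:X_1\times X_2\times\Omega\to R$ are such that, for every $\omega$, $e(\cdot,\cdot,\omega)$ is continuous and linear and $i(\cdot,\cdot,\omega)$ is continuous and $K$-convex, i.e. $i(tp+(1-t)q,\omega)\le_K t\,i(p,\omega)+(1-t)\,i(q,\omega)$ for $p,q\in X_1\times X_2$, $t\in(0,1)$; for all $(x_1,x_2)$, $e(x_1,x_2,\cdot)$ and $i(x_1,x_2,\cdot)$ are strongly $\mathbb P$-measurable; and for every $r>0$ there are $b_{r,e},b_{r,i}>0$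 such that for all $\|x_1\|+\|x_2\|\le r$ one has $\|e(x_1,x_2,\omega)\|_W\le b_{r,e}$ and $\|i(x_1,x_2,\omega)\|_R\le b_{r,i}$ a.s. *Primal problem.* On $X=X_1\times L^\infty(\Omega,X_2)$ let $j(x)=J_1(x_1)+\mathbb E[J_2(x_1,x_2(\cdot))]$. Let $\inf \mathrm P\in[-\infty,\infty]$ be the infimum of $j(x)$ over all $x\in X$ with $x_1\in C_1$ and, a.s., $x_2(\omega)\in C_2$, $e(x_1,x_2(\omega),\omega)=0$, $i(x_1,x_2(\omega),\omega)\le_K0$. *Dual problem.* For $u=(u_e,u_i)\in U=L^\infty(\Omega,W)\times L^\infty(\Omega,R)$ let $\varphi(x,u)=j(x)$ if $x_1\in C_1$ and, a.s., $x_2(\omega)\in C_2$, $e(x_1,x_2(\omega),\omega)=u_e(\omega)$, $i(x_1,x_2(\omega),\omega)\le_K u_i(\omega)$; otherwise let $\varphi(x,u)=\infty$. Put $v(u)=\inf_{x\in X}\varphi(x,u)$ and $\operatorname{dom}v=\{u\in U: v(u)<\infty\}$. For $\lambda=(\lambda_e,\lambda_i)\in\Lambda=L^1(\Omega,W^*)\times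 L^1(\Omega,R^*)$ put $\langle u,\lambda\rangle=\int_\Omega \langle \lambda_e(\omega),u_e(\omega)\rangle+\langle\lambda_i(\omega),u_i(\omega)\rangle\,d\mathbb P(\omega)$, $L(x,\lambda)=\inf_{u\in U}\{\langle u,\lambda\rangle+\varphi(x,u)\}$ and $g(\lambda)=\inf_{x\in X}L(x,\lambda)$. The dual problem (D) is to maximize $g$ over $\Lambda$. Suppose that Assumption 1 holds, that relatively complete recourse holds (for every $x_1\in C_1$ there is $x_2\in L^\infty(\Omega,X_2)$ with $x_2(\omega)\in C_2$, $e(x_1,x_2(\omega),\omega)=0$ and $i(x_1,x_2(\omega),\omega)\le_K0$ a.s.), and that the problem is strictly feasible, i.e. $0\in\operatorname{int}\operatorname{dom}v$ in the norm topology of $U$. Then $$\inf \mathrm P=\max \mathrm D<\infty,$$ that is, $\inf\mathrm P<\infty$ and there is $\bar\lambda\in\Lambda$ with $g(\bar\lambda)=\max_{\lambda\in\Lambda}g(\lambda)=\inf\mathrm P$ (the common value may be $-\infty$, and the primal infimum need not be attained). -/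

import Mathlib

open MeasureTheory Set
open scoped ENNReal

noncomputable section

/-- Data of a convex two-stage problem: constraint sets `C₁`, `C₂`, the closed convex cone `K`
(`r ≤_K s` means `s - r ∈ K`), the cost `J (x₁, x₂) = J₁ x₁ + J₂ (x₁, x₂)`, the equality constraint
map `e` and the inequality constraint map `i`. -/
structure TwoStageProblem (Ω X₁ X₂ W R : Type*)
    [NormedAddCommGroup R] [NormedSpace ℝ R] where
  C₁ : Set X₁
  C₂ : Set X₂
  /-- A nonempty closed convex cone. -/
  K : ProperCone ℝ R
  J₁ : X₁ → ℝ
  J₂ : X₁ → X₂ → ℝ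
  e : X₁ → X₂ → Ω → W
  i : X₁ → X₂ → Ω → R

namespace TwoStageProblem

variable {Ω X₁ X₂ W R : Type*} [MeasurableSpace Ω]
  [NormedAddCommGroup X₁] [NormedSpace ℝ X₁] [NormedAddCommGroup X₂] [NormedSpace ℝ X₂]
  [NormedAddCommGroup W] [NormedSpace ℝ W] [NormedAddCommGroup R] [NormedSpace ℝ R]

/-- The standing assumptions on the data. -/
structure StandingAssumption (P : TwoStageProblem Ω X₁ X₂ W R) (μ : Measure Ω) : Prop where
  C₁_nonempty : P.C₁.Nonempty
  C₁_closed : IsClosed P.C₁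
  C₁_convex : Convex ℝ P.C₁
  C₂_nonempty : P.C₂.Nonempty
  C₂_closed : IsClosed P.C₂
  C₂_convex : Convex ℝ P.C₂
  /-- `J = J₁ + J₂` is jointly convex. -/
  J_convex : ConvexOn ℝ univ (fun p : X₁ × X₂ => P.J₁ p.1 + P.J₂ p.1 p.2)
  J₂_bound : ∀ r > 0, ∃ a > 0, ∀ x₁ x₂, ‖x₁‖ + ‖x₂‖ ≤ r → |P.J₂ x₁ x₂| ≤ a
  e_linear : ∀ ω, IsLinearMap ℝ (fun p : X₁ × X₂ => P.e p.1 p.2 ω)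
  e_continuous : ∀ ω, Continuous (fun p : X₁ × X₂ => P.e p.1 p.2 ω)
  e_measurable : ∀ x₁ x₂, AEStronglyMeasurable (P.e x₁ x₂) μ
  e_bound : ∀ r > 0, ∃ b > 0, ∀ x₁ x₂, ‖x₁‖ + ‖x₂‖ ≤ r → ∀ᵐ ω ∂μ, ‖P.e x₁ x₂ ω‖ ≤ b
  i_continuous : ∀ ω, Continuous (fun p : X₁ × X₂ => P.i p.1 p.2 ω)
  /-- `i (·, ·, ω)` is `K`-convex. -/
  i_convex : ∀ ω, ∀ p q : X₁ × X₂, ∀ t : ℝ, 0 < t → t < 1 →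
    (t • P.i p.1 p.2 ω + (1 - t) • P.i q.1 q.2 ω)
      - P.i (t • p.1 + (1 - t) • q.1) (t • p.2 + (1 - t) • q.2) ω ∈ P.K
  i_measurable : ∀ x₁ x₂, AEStronglyMeasurable (P.i x₁ x₂) μ
  i_bound : ∀ r > 0, ∃ b > 0, ∀ x₁ x₂, ‖x₁‖ + ‖x₂‖ ≤ r → ∀ᵐ ω ∂μ, ‖P.i x₁ x₂ ω‖ ≤ b

variable (P : TwoStageProblem Ω X₁ X₂ W R) (μ : Measure Ω)

/-- The objective `j (x) = J₁ (x₁) + 𝔼[J₂ (x₁, x₂ (·))]` on `X₁ × L^∞(Ω, X₂)`. -/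
def objective (x : X₁ × Lp X₂ ∞ μ) : ℝ :=
  P.J₁ x.1 + ∫ ω, P.J₂ x.1 (x.2 ω) ∂μ

/-- The admissible set of the primal problem. -/
def admissible : Set (X₁ × Lp X₂ ∞ μ) :=
  {x | x.1 ∈ P.C₁ ∧ (∀ᵐ ω ∂μ, x.2 ω ∈ P.C₂) ∧ (∀ᵐ ω ∂μ, P.e x.1 (x.2 ω) ω = 0) ∧
    ∀ᵐ ω ∂μ, -P.i x.1 (x.2 ω) ω ∈ P.K}

/-- The optimal value `inf P` of the primal problem. -/
def infPrimal : EReal := ⨅ x ∈ P.admissible μ, (P.objective μ x : EReal)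

/-- The admissible set of the problem perturbed by `u = (u_e, u_i) ∈ U`. -/
def perturbedAdmissible (u : Lp W ∞ μ × Lp R ∞ μ) : Set (X₁ × Lp X₂ ∞ μ) :=
  {x | x.1 ∈ P.C₁ ∧ (∀ᵐ ω ∂μ, x.2 ω ∈ P.C₂) ∧ (∀ᵐ ω ∂μ, P.e x.1 (x.2 ω) ω = u.1 ω) ∧
    ∀ᵐ ω ∂μ, u.2 ω - P.i x.1 (x.2 ω) ω ∈ P.K}

open Classical in
/-- The perturbation function `φ (x, u)`. -/
def perturbation (x : X₁ × Lp X₂ ∞ μ) (u : Lp W ∞ μ × Lp R ∞ μ) : EReal :=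
  if x ∈ P.perturbedAdmissible μ u then (P.objective μ x : EReal) else ⊤

/-- The value function `v (u) = inf_x φ (x, u)`. -/
def valueFunction (u : Lp W ∞ μ × Lp R ∞ μ) : EReal := ⨅ x, P.perturbation μ x u

/-- The pairing of `U = L^∞(Ω, W) × L^∞(Ω, R)` with `Λ = L¹(Ω, W*) × L¹(Ω, R*)`. -/
def pairing (u : Lp W ∞ μ × Lp R ∞ μ)
    (l : Lp (StrongDual ℝ W) 1 μ × Lp (StrongDual ℝ R) 1 μ) : ℝ :=
  ∫ ω, (l.1 ω (u.1 ω) + l.2 ω (u.2 ω)) ∂μ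

/-- The generalized Lagrangian `L (x, λ) = inf_u {⟨u, λ⟩ + φ (x, u)}`. -/
def lagrangian (x : X₁ × Lp X₂ ∞ μ)
    (l : Lp (StrongDual ℝ W) 1 μ × Lp (StrongDual ℝ R) 1 μ) : EReal :=
  ⨅ u, ((pairing μ u l : ℝ) : EReal) + P.perturbation μ x u

/-- The dual objective `g (λ) = inf_x L (x, λ)`. -/
def dualObjective (l : Lp (StrongDual ℝ W) 1 μ × Lp (StrongDual ℝ R) 1 μ) : EReal :=
  ⨅ x, P.lagrangian μ x l

/-- The induced feasible set for the first-stage variable. -/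
def inducedFeasible : Set X₁ :=
  {x₁ | ∃ x₂ : Lp X₂ ∞ μ, (∀ᵐ ω ∂μ, P.e x₁ (x₂ ω) ω = 0) ∧
    (∀ᵐ ω ∂μ, -P.i x₁ (x₂ ω) ω ∈ P.K) ∧ ∀ᵐ ω ∂μ, x₂ ω ∈ P.C₂}

/-- Relatively complete recourse. -/
def RelativelyCompleteRecourse : Prop := P.C₁ ⊆ P.inducedFeasible μ

/-- Strict feasibility: `0 ∈ int dom v`, where `dom v = {u | v u < ∞}`. -/
def StrictlyFeasible : Prop :=
  (0 : Lp W ∞ μ × Lp R ∞ μ) ∈ interior {u | P.valueFunction μ u < ⊤}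

end TwoStageProblem

end

/-! The convex set of all (u, r) for which some x feasible for u has j(x) ≤ r is separated from the
point (0, inf P). Two things need work: this set must have interior points, and the separating
functional, which lives in the dual of L^∞, must be replaced by a pair of L¹ densities.

Interior: J₁ may be unbounded on bounded sets, so norm bounds on feasible points do not bound j. The
feasible pairs (x, u) form a closed convex set. The Robinson-Ursescu theorem
(`exists_bounded_preimage_of_mem_interior`), applied with a recourse as an extra coordinate, gives
bounded feasible points and bounded recourses for all small u. If v were not bounded above near 0,
there would be bad perturbations uₙ so small that 2^(n+1) uₙ are still admissible. Averaging the
first stages of points feasible for 2^(k+1) uₖ with weights 2^-(k+1) gives one x₁, independent of n.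
Keeping only the n-th perturbation, and the recourse in every other term, shows that x₁ is feasible
for uₙ with a bounded second stage. The cost is then at most J₁(x₁) plus a constant, a contradiction
(`exists_objective_le`).

Density: a functional F on L^∞ is countably additive on sets Eₙ that exhaust Ω almost everywhere
(the Yosida-Hewitt phenomenon). It has an integrable density there, because the dual of a separable
reflexive space is separable (`exists_integrable_density`). By relatively complete recourse, a point
feasible for u can be replaced by a recourse off such a set; the result is feasible for u cut to the
set, where F is its density. Dominated convergence then removes the singular part
(`exists_integrable_multiplier`). -/

section

open Filter Topology

/-! ### Geometric convex series and the Robinson-Ursescu theorem -/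

/-- A closed convex set is stable under geometric series of convex weights. -/
theorem Convex.mem_of_hasSum_geometric {E : Type*} [NormedAddCommGroup E] [NormedSpace ℝ E]
    {C : Set E} (hC : Convex ℝ C) (hc : IsClosed C) {p : ℕ → E} (hp : ∀ k, p k ∈ C) {x : E}
    (hx : HasSum (fun k => ((1 / 2 : ℝ) ^ (k + 1)) • p k) x) : x ∈ C := by
  -- The first n weights add up to 1 - 2⁻ⁿ. The missing mass sits on a point q, left arbitrary so
  -- that the induction can replace it by a midpoint.
  have key : ∀ n : ℕ, ∀ q ∈ C,
      ∑ k ∈ Finset.range n, ((1 / 2 : ℝ) ^ (k + 1)) • p k + ((1 / 2 : ℝ) ^ n) • q ∈ C := by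
    intro n
    induction n with
    | zero => intro q hq; simpa using hq
    | succ n ih =>
      intro q hq
      have hmid : (1 / 2 : ℝ) • p n + (1 / 2 : ℝ) • q ∈ C :=
        hC (hp n) hq (by norm_num) (by norm_num) (by norm_num)
      convert! ih _ hmid using 1
      rw [Finset.sum_range_succ, smul_add, smul_smul, smul_smul, ← pow_succ]
      abel
  have hlim : Tendsto (fun n : ℕ => ∑ k ∈ Finset.range n, ((1 / 2 : ℝ) ^ (k + 1)) • p k
      + ((1 / 2 : ℝ) ^ n) • p 0) atTop (𝓝 (x + (0 : ℝ) • p 0)) :=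
    hx.tendsto_sum_nat.add
      ((tendsto_pow_atTop_nhds_zero_of_lt_one (by norm_num) (by norm_num)).smul_const _)
  rw [zero_smul, add_zero] at hlim
  exact hc.mem_of_tendsto hlim (Eventually.of_forall fun n => key n _ (hp 0))

theorem summable_geometric_smul_of_norm_le {E : Type*} [NormedAddCommGroup E] [NormedSpace ℝ E]
    [CompleteSpace E] {p : ℕ → E} {M : ℝ} (hp : ∀ k, ‖p k‖ ≤ M) :
    Summable (fun k => ((1 / 2 : ℝ) ^ (k + 1)) • p k) := by
  have hs : Summable (fun k : ℕ => (1 / 2 : ℝ) ^ (k + 1) * M) :=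
    ((summable_nat_add_iff 1).2 summable_geometric_two).mul_right M
  refine Summable.of_norm_bounded hs fun k => ?_
  rw [norm_smul, Real.norm_of_nonneg (by positivity)]
  gcongr
  exact hp k

/-- A geometric series of vectors of norm at most `M` has norm at most `M`. -/
theorem norm_le_of_hasSum_geometric {E : Type*} [NormedAddCommGroup E] [NormedSpace ℝ E]
    {p : ℕ → E} {M : ℝ} (hp : ∀ k, ‖p k‖ ≤ M) {x : E}
    (hx : HasSum (fun k => ((1 / 2 : ℝ) ^ (k + 1)) • p k) x) : ‖x‖ ≤ M := by
  have := (convex_closedBall (0 : E) M).mem_of_hasSum_geometric Metric.isClosed_closedBall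
    (fun k => by simpa using hp k) hx
  simpa using this

/-- A convex, series-closed image absorbs a ball as soon as its closure does. -/
theorem exists_bounded_preimage_of_subset_closure {Z U : Type*}
    [NormedAddCommGroup Z] [NormedSpace ℝ Z] [CompleteSpace Z]
    [NormedAddCommGroup U] [NormedSpace ℝ U] [CompleteSpace U]
    {G : Set (Z × U)} (hG : Convex ℝ G) (hc : IsClosed G) {M η : ℝ} (hη : 0 < η)
    (h : Metric.ball (0 : U) η ⊆ closure {u | ∃ z, ‖z‖ ≤ M ∧ (z, u) ∈ G}) {u : U}
    (hu : ‖u‖ < η / 2) : ∃ z, ‖z‖ ≤ M ∧ (z, u) ∈ G := by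
  have step : ∀ r : U, ∃ s : U, (‖r‖ < η / 2 → ‖(2 : ℝ) • r - s‖ < η / 2 ∧
      ∃ z, ‖z‖ ≤ M ∧ (z, s) ∈ G) := by
    intro r
    by_cases hr : ‖r‖ < η / 2
    · have h2 : (2 : ℝ) • r ∈ Metric.ball (0 : U) η := by
        rw [mem_ball_zero_iff, norm_smul]
        norm_num
        linarith
      obtain ⟨s, hs, hd⟩ := Metric.mem_closure_iff.1 (h h2) (η / 2) (by positivity)
      exact ⟨s, fun _ => ⟨by rwa [← dist_eq_norm], hs⟩⟩
    · exact ⟨0, fun h => absurd h hr⟩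
  choose s hs using step
  -- The residual is doubled at each stage and stays below η/2. Hence u is the sum of 2^-(k+1) s(r
  -- k) over k < n plus 2⁻ⁿ r n: a convex series rather than a plain iteration, so no homogeneity of
  -- `G` is needed.
  let r : ℕ → U := fun n => Nat.rec u (fun _ r => (2 : ℝ) • r - s r) n
  have hr : ∀ n, ‖r n‖ < η / 2 := by
    intro n
    induction n with
    | zero => exact hu
    | succ n ih => exact (hs _ ih).1
  choose z hzM hzG using fun n => (hs _ (hr n)).2
  have hsum : ∀ n, ∑ k ∈ Finset.range n, ((1 / 2 : ℝ) ^ (k + 1)) • s (r k)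
      = u - ((1 / 2 : ℝ) ^ n) • r n := by
    intro n
    induction n with
    | zero => simp [r]
    | succ n ih =>
      have hrs : r (n + 1) = (2 : ℝ) • r n - s (r n) := rfl
      rw [Finset.sum_range_succ, ih, hrs, smul_sub, smul_smul,
        show (1 / 2 : ℝ) ^ (n + 1) * 2 = (1 / 2) ^ n by rw [pow_succ]; ring]
      abel
  have hM : ∀ k, ‖s (r k)‖ ≤ 2 * η := by
    intro k
    have h1 := (hs _ (hr k)).1
    have h2 := hr k
    have h3 : s (r k) = (2 : ℝ) • r k - ((2 : ℝ) • r k - s (r k)) := by abel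
    rw [h3]
    refine (norm_sub_le _ _).trans ?_
    rw [norm_smul]
    norm_num
    linarith
  have hsu : HasSum (fun k => ((1 / 2 : ℝ) ^ (k + 1)) • s (r k)) u := by
    have hs' := summable_geometric_smul_of_norm_le hM
    refine (hs'.hasSum_iff_tendsto_nat).2 ?_
    simp_rw [hsum]
    have : Tendsto (fun n : ℕ => ((1 / 2 : ℝ) ^ n) • r n) atTop (𝓝 0) := by
      refine squeeze_zero_norm (a := fun n : ℕ => (1 / 2 : ℝ) ^ n * (η / 2)) (fun n => ?_) ?_
      · rw [norm_smul, Real.norm_of_nonneg (by positivity)]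
        gcongr
        exact (hr n).le
      · simpa using (tendsto_pow_atTop_nhds_zero_of_lt_one (r := (1 / 2 : ℝ)) (by norm_num)
          (by norm_num)).mul_const (η / 2)
    simpa using tendsto_const_nhds.sub this
  obtain ⟨x, hx⟩ := summable_geometric_smul_of_norm_le hzM
  refine ⟨x, norm_le_of_hasSum_geometric hzM hx, ?_⟩
  exact hG.mem_of_hasSum_geometric hc (p := fun k => (z k, s (r k))) hzG (hx.prodMk hsu)

/-- The Robinson-Ursescu theorem at the origin. -/
theorem exists_bounded_preimage_of_mem_interior {Z U : Type*}
    [NormedAddCommGroup Z] [NormedSpace ℝ Z] [CompleteSpace Z]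
    [NormedAddCommGroup U] [NormedSpace ℝ U] [CompleteSpace U]
    {G : Set (Z × U)} (hG : Convex ℝ G) (hc : IsClosed G)
    (h : (0 : U) ∈ interior (Prod.snd '' G)) :
    ∃ M : ℝ, ∃ ε > 0, ∀ u : U, ‖u‖ < ε → ∃ z, ‖z‖ ≤ M ∧ (z, u) ∈ G := by
  set S : ℝ → Set U := fun M => {u | ∃ z, ‖z‖ ≤ M ∧ (z, u) ∈ G} with hS
  have hmono : ∀ {a b : ℝ}, a ≤ b → S a ⊆ S b := fun hab u ⟨z, hz, hzu⟩ => ⟨z, hz.trans hab, hzu⟩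
  have hconv : ∀ M, Convex ℝ (S M) := by
    rintro M u ⟨z, hz, hzu⟩ u' ⟨z', hz', hzu'⟩ a b ha hb hab
    refine ⟨a • z + b • z', ?_, hG hzu hzu' ha hb hab⟩
    have := convex_closedBall (0 : Z) M (by simpa using hz) (by simpa using hz') ha hb hab
    simpa using this
  obtain ⟨ε, hε, hball⟩ := Metric.mem_nhds_iff.1 (mem_interior_iff_mem_nhds.1 h)
  obtain ⟨⟨z₀, _⟩, hz₀, rfl⟩ := interior_subset h
  -- One index serves both as scaling factor and as norm bound, so countably many closed sets cover
  -- U and Baire's theorem applies.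
  have hcover : ∀ u : U, ∃ n : ℕ, ((n : ℝ) + 1)⁻¹ • u ∈ S n := by
    intro u
    obtain ⟨m, hm⟩ := exists_nat_gt (‖u‖ / ε)
    have hm0 : (0 : ℝ) < (m : ℝ) + 1 := by positivity
    have hlt : ‖((m : ℝ) + 1)⁻¹ • u‖ < ε := by
      rw [norm_smul, norm_inv, Real.norm_of_nonneg hm0.le, inv_mul_lt_iff₀ hm0]
      rw [div_lt_iff₀ hε] at hm
      linarith
    obtain ⟨⟨z, u'⟩, hz, hu'⟩ := hball (mem_ball_zero_iff.2 hlt)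
    simp only at hu'
    subst hu'
    obtain ⟨n, hn⟩ := exists_nat_ge (max (max ‖z‖ ‖z₀‖) m)
    have hmn : (m : ℝ) ≤ n := (le_max_right _ _).trans hn
    refine ⟨n, ?_⟩
    have h0 : (0 : U) ∈ S n := ⟨z₀, ((le_max_right _ _).trans (le_max_left _ _)).trans hn, hz₀⟩
    have h1 : ((m : ℝ) + 1)⁻¹ • u ∈ S n :=
      ⟨z, ((le_max_left _ _).trans (le_max_left _ _)).trans hn, hz⟩
    have h2 := (hconv n).smul_mem_of_zero_mem h0 h1 (t := ((m : ℝ) + 1) / (n + 1))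
      ⟨by positivity, by rw [div_le_one (by positivity)]; linarith⟩
    rwa [smul_smul, div_mul_eq_mul_div, mul_inv_cancel₀ hm0.ne', one_div] at h2
  obtain ⟨n, u, hu⟩ := nonempty_interior_of_iUnion_of_closed
    (f := fun n : ℕ => {u : U | ((n : ℝ) + 1)⁻¹ • u ∈ closure (S n)})
    (fun n => isClosed_closure.preimage (continuous_const_smul _))
    (eq_univ_of_forall fun u => mem_iUnion.2 <| (hcover u).imp fun n hn => subset_closure hn)
  have hn0 : ((n : ℝ) + 1) ≠ 0 := by positivity
  have hu₁ : ((n : ℝ) + 1)⁻¹ • u ∈ interior (closure (S n)) := by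
    have hpre := preimage_interior_subset_interior_preimage
      (continuous_const_smul ((n : ℝ) + 1) : Continuous fun v : U => ((n : ℝ) + 1) • v)
      (t := {u : U | ((n : ℝ) + 1)⁻¹ • u ∈ closure (S n)})
    have := hpre (a := ((n : ℝ) + 1)⁻¹ • u) (by
      rw [mem_preimage, smul_inv_smul₀ hn0]; exact hu)
    simpa [smul_smul, inv_mul_cancel₀ hn0] using! this
  generalize ((n : ℝ) + 1)⁻¹ • u = u₁ at hu₁
  obtain ⟨m, hm⟩ := hcover (-u₁)
  set N : ℝ := max n m
  set t : ℝ := ((m : ℝ) + 1)⁻¹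
  have ht : 0 < t := by positivity
  -- The origin is a convex combination of the interior point u₁ and the point -t u₁, with weights
  -- t/(1+t) and 1/(1+t).
  have h0 : (0 : U) ∈ interior (closure (S N)) := by
    have h1 := interior_mono (closure_mono (hmono (le_max_left (n : ℝ) m))) hu₁
    have h2 := subset_closure (hmono (le_max_right (n : ℝ) m) hm)
    have h3 := (hconv N).closure.combo_interior_self_mem_interior h1 h2
      (a := t / (1 + t)) (b := 1 / (1 + t)) (by positivity) (by positivity) (by field_simp; ring)
    convert! h3 using 1
    rw [smul_neg, smul_neg, smul_smul, one_div, ← sub_eq_add_neg, ← sub_smul,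
      div_eq_inv_mul, sub_self, zero_smul]
  obtain ⟨η, hη, hηS⟩ := Metric.mem_nhds_iff.1 (mem_interior_iff_mem_nhds.1 h0)
  exact ⟨N, η / 2, by positivity, fun u hu =>
    exists_bounded_preimage_of_subset_closure hG hc hη hηS hu⟩

/-! ### Separability of duals and extension from dense subgroups -/

/-- A normed space with separable dual is separable. -/
theorem separableSpace_of_separableSpace_dual (E : Type*) [NormedAddCommGroup E] [NormedSpace ℝ E]
    [TopologicalSpace.SeparableSpace (StrongDual ℝ E)] : TopologicalSpace.SeparableSpace E := by
  set f := TopologicalSpace.denseSeq (StrongDual ℝ E)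
  have hx : ∀ n, ∃ x : E, ‖x‖ ≤ 1 ∧ ‖f n‖ / 2 ≤ |f n x| := by
    intro n
    by_contra! hcon
    by_cases h0 : ‖f n‖ = 0
    · have := hcon 0 (by simp)
      simp [h0] at this
    · have hpos : 0 < ‖f n‖ := lt_of_le_of_ne (norm_nonneg _) (Ne.symm h0)
      have := (f n).opNorm_le_of_unit_norm (C := ‖f n‖ / 2) (by positivity)
        (fun x hx => (hcon x hx.le).le)
      linarith
  choose x hx1 hx2 using hx
  set p : Submodule ℝ E := (Submodule.span ℝ (range x)).topologicalClosure
  have hsep : TopologicalSpace.IsSeparable (p : Set E) :=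
    ((countable_range x).isSeparable.span (R := ℝ)).closure
  suffices hp : (p : Set E) = univ by
    rw [hp] at hsep
    exact TopologicalSpace.isSeparable_univ_iff.1 hsep
  by_contra hne
  obtain ⟨y, hy⟩ := (ne_univ_iff_exists_notMem _).1 hne
  obtain ⟨g, s, hgp, hgy⟩ := geometric_hahn_banach_closed_point p.convex
    (Submodule.isClosed_topologicalClosure _) hy
  have hs : 0 < s := by simpa using hgp 0 p.zero_mem
  have hg0 : ∀ a ∈ p, g a = 0 := by
    intro a ha
    by_contra h0
    have := hgp ((s / g a) • a) (p.smul_mem _ ha)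
    rw [map_smul, smul_eq_mul, div_mul_cancel₀ _ h0] at this
    exact lt_irrefl _ this
  have hgpos : 0 < ‖g‖ := by
    rw [norm_pos_iff]
    rintro rfl
    simp at hgy
    linarith
  -- As g kills every x n, an approximant within ‖g‖/4 satisfies ‖f n‖/2 ≤ |f n (x n)| < ‖g‖/4,
  -- while ‖f n‖ > 3‖g‖/4.
  obtain ⟨_, hn, n, rfl⟩ := Metric.dense_iff.1
    (TopologicalSpace.denseRange_denseSeq (StrongDual ℝ E)) g (‖g‖ / 4) (by positivity)
  rw [Metric.mem_ball, dist_eq_norm] at hn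
  have h1 : |f n (x n)| ≤ ‖f n - g‖ := by
    have h2 : f n (x n) = (f n - g) (x n) := by
      rw [_root_.sub_apply, hg0 (x n), sub_zero]
      exact Submodule.le_topologicalClosure _ (Submodule.subset_span (mem_range_self n))
    rw [h2, ← Real.norm_eq_abs]
    exact ((f n - g).le_opNorm _).trans (mul_le_of_le_one_right (norm_nonneg _) (hx1 n))
  have h3 := hx2 n
  have h4 : ‖g‖ ≤ ‖f n‖ + ‖f n - g‖ := by
    have := norm_sub_le (f n) (f n - g)
    rwa [sub_sub_cancel] at this
  change ‖f n - g‖ < _ at hn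
  linarith

/-- The dual of a separable reflexive space is separable. -/
theorem separableSpace_dual_of_surjective_inclusionInDoubleDual {E : Type*} [NormedAddCommGroup E]
    [NormedSpace ℝ E] [TopologicalSpace.SeparableSpace E]
    (hE : Function.Surjective (NormedSpace.inclusionInDoubleDual ℝ E)) :
    TopologicalSpace.SeparableSpace (StrongDual ℝ E) := by
  have : TopologicalSpace.SeparableSpace (StrongDual ℝ (StrongDual ℝ E)) :=
    hE.denseRange.separableSpace (NormedSpace.inclusionInDoubleDual ℝ E).continuous
  exact separableSpace_of_separableSpace_dual (StrongDual ℝ E)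

/-- A bounded additive function on a dense subgroup extends to a bounded linear functional. -/
theorem exists_dual_extension_of_dense {E : Type*} [NormedAddCommGroup E] [NormedSpace ℝ E]
    {D : AddSubgroup E} (hD : Dense (D : Set E)) (φ : D →+ ℝ) {C : ℝ} (hC : 0 ≤ C)
    (hφ : ∀ d : D, |φ d| ≤ C * ‖(d : E)‖) :
    ∃ f : StrongDual ℝ E, (∀ d : D, f d = φ d) ∧ ‖f‖ ≤ C := by
  have hlip : LipschitzWith ⟨C, hC⟩ φ := LipschitzWith.of_dist_le_mul fun a b => by
    rw [dist_eq_norm, dist_eq_norm, ← map_sub]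
    exact hφ (a - b)
  have hui : IsUniformInducing ((↑) : D → E) := isUniformInducing_val _
  have hdr : DenseRange ((↑) : D → E) := hD.denseRange_val
  set ψ := (hui.isDenseInducing hdr).extend φ
  have hψc : Continuous ψ :=
    (uniformContinuous_uniformly_extend hui hdr hlip.uniformContinuous).continuous
  have hψ : ∀ d : D, ψ d = φ d := fun d =>
    uniformly_extend_of_ind hui hdr hlip.uniformContinuous d
  have hadd : ∀ a b, ψ (a + b) = ψ a + ψ b :=
    isClosed_property2 hdr (isClosed_eq (by fun_prop) (by fun_prop)) fun a b => by
      rw [← AddSubgroup.coe_add, hψ, hψ, hψ, map_add]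
  have hbd : ∀ a, ‖ψ a‖ ≤ C * ‖a‖ :=
    isClosed_property hdr (isClosed_le (by fun_prop) (by fun_prop)) fun a => by
      rw [hψ]; exact hφ a
  -- A continuous additive map is automatically ℝ-linear. This is why a dense subgroup suffices and
  -- no rational scalars are tracked.
  let f : StrongDual ℝ E := AddMonoidHom.toRealLinearMap (AddMonoidHom.mk' ψ hadd) hψc
  exact ⟨f, hψ, f.opNorm_le_bound hC hbd⟩

/-- A separable normed space has a countable dense additive subgroup. -/
theorem exists_countable_dense_addSubgroup (E : Type*) [NormedAddCommGroup E]
    [TopologicalSpace.SeparableSpace E] :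
    ∃ D : AddSubgroup E, Countable D ∧ Dense (D : Set E) := by
  obtain ⟨s, hs, hd⟩ := TopologicalSpace.exists_countable_dense E
  have := hs.to_subtype
  let π : (s →₀ ℤ) →+ E := Finsupp.liftAddHom fun x => (zmultiplesHom E) x
  refine ⟨π.range, ?_, hd.mono fun x hx => ⟨Finsupp.single ⟨x, hx⟩ 1, by simp [π]⟩⟩
  exact (countable_range π).to_subtype

/-! ### The variation of a functional on L^∞ and its countably additive part -/

section DualOfLInfty

variable {Ω W : Type*} [MeasurableSpace Ω] {μ : Measure Ω}
  [NormedAddCommGroup W]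

/-- The restriction of an essentially bounded function to a measurable set. -/
noncomputable def lpCut (A : Set Ω) (hA : MeasurableSet A) (u : Lp W ∞ μ) : Lp W ∞ μ :=
  ((Lp.memLp u).indicator hA).toLp (A.indicator u)

theorem coeFn_lpCut (A : Set Ω) (hA : MeasurableSet A) (u : Lp W ∞ μ) :
    lpCut A hA u =ᵐ[μ] A.indicator u := MemLp.coeFn_toLp _

theorem Lp.ae_norm_le_norm (u : Lp W ∞ μ) : ∀ᵐ ω ∂μ, ‖u ω‖ ≤ ‖u‖ := by
  filter_upwards [ae_le_eLpNormEssSup (f := u) (μ := μ)] with ω hω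
  rw [Lp.norm_def, eLpNorm_exponent_top, ← toReal_enorm]
  exact ENNReal.toReal_mono (by simpa using (Lp.memLp u).eLpNorm_lt_top.ne) hω

theorem Lp.norm_le_of_ae_norm_le {u : Lp W ∞ μ} {C : ℝ} (hC : 0 ≤ C)
    (h : ∀ᵐ ω ∂μ, ‖u ω‖ ≤ C) : ‖u‖ ≤ C := by
  rw [Lp.norm_def, eLpNorm_exponent_top]
  exact ENNReal.toReal_le_of_le_ofReal hC (eLpNormEssSup_le_of_ae_bound h)

theorem norm_lpCut_le (A : Set Ω) (hA : MeasurableSet A) (u : Lp W ∞ μ) :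
    ‖lpCut A hA u‖ ≤ ‖u‖ := by
  refine Lp.norm_le_of_ae_norm_le (norm_nonneg _) ?_
  filter_upwards [coeFn_lpCut A hA u, Lp.ae_norm_le_norm u] with ω h1 h2
  rw [h1]
  exact (norm_indicator_le_norm_self _ _).trans h2

theorem lpCut_eq_zero_of_notMem (A : Set Ω) (hA : MeasurableSet A) (u : Lp W ∞ μ) :
    ∀ᵐ ω ∂μ, ω ∉ A → lpCut A hA u ω = 0 := by
  filter_upwards [coeFn_lpCut A hA u] with ω h hω
  rw [h, indicator_of_notMem hω]

theorem lpCut_add_lpCut_compl (A : Set Ω) (hA : MeasurableSet A) (u : Lp W ∞ μ) :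
    lpCut A hA u + lpCut Aᶜ hA.compl u = u := by
  apply Lp.ext
  filter_upwards [Lp.coeFn_add (lpCut A hA u) (lpCut Aᶜ hA.compl u), coeFn_lpCut A hA u,
    coeFn_lpCut Aᶜ hA.compl u] with ω h1 h2 h3
  rw [h1, Pi.add_apply, h2, h3, ← Pi.add_apply, indicator_self_add_compl]

/-- The unit ball of the space of essentially bounded functions supported in `A`. -/
def lpUnitBallOn (W : Type*) [NormedAddCommGroup W] (μ : Measure Ω) (A : Set Ω) :
    Set (Lp W ∞ μ) :=
  {u | ‖u‖ ≤ 1 ∧ ∀ᵐ ω ∂μ, ω ∉ A → u ω = 0}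

theorem zero_mem_lpUnitBallOn (A : Set Ω) : (0 : Lp W ∞ μ) ∈ lpUnitBallOn W μ A := by
  refine ⟨by simp, ?_⟩
  filter_upwards [Lp.coeFn_zero W ∞ μ] with ω h _
  rw [h, Pi.zero_apply]

instance (A : Set Ω) : Nonempty (lpUnitBallOn W μ A) := ⟨⟨0, zero_mem_lpUnitBallOn A⟩⟩

variable [NormedSpace ℝ W]

/-- The variation of a functional on `L^∞` over the set `A`. -/
noncomputable def dualVariation (F : StrongDual ℝ (Lp W ∞ μ)) (A : Set Ω) : ℝ≥0∞ :=
  ⨆ u : lpUnitBallOn W μ A, ENNReal.ofReal (F u)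

theorem ofReal_le_dualVariation (F : StrongDual ℝ (Lp W ∞ μ)) {A : Set Ω} {u : Lp W ∞ μ}
    (hu : u ∈ lpUnitBallOn W μ A) : ENNReal.ofReal (F u) ≤ dualVariation F A :=
  le_iSup (fun u : lpUnitBallOn W μ A => ENNReal.ofReal (F u)) ⟨u, hu⟩

theorem dualVariation_le_norm (F : StrongDual ℝ (Lp W ∞ μ)) (A : Set Ω) :
    dualVariation F A ≤ ENNReal.ofReal ‖F‖ := by
  refine iSup_le fun ⟨u, hu, _⟩ => ENNReal.ofReal_le_ofReal ?_
  exact (le_abs_self _).trans ((F.le_opNorm u).trans (mul_le_of_le_one_right (norm_nonneg _) hu))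

theorem dualVariation_ne_top (F : StrongDual ℝ (Lp W ∞ μ)) (A : Set Ω) : dualVariation F A ≠ ∞ :=
  ((dualVariation_le_norm F A).trans_lt ENNReal.ofReal_lt_top).ne

theorem dualVariation_of_null (F : StrongDual ℝ (Lp W ∞ μ)) {A : Set Ω} (hA : μ A = 0) :
    dualVariation F A = 0 := by
  refine le_antisymm (iSup_le fun ⟨u, _, hu⟩ => ?_) zero_le
  have : u = 0 := by
    apply Lp.ext
    filter_upwards [hu, measure_eq_zero_iff_ae_notMem.1 hA, Lp.coeFn_zero W ∞ μ] with ω h1 h2 h3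
    rw [h1 h2, h3, Pi.zero_apply]
  simp [this]

theorem abs_le_norm_mul_dualVariation (F : StrongDual ℝ (Lp W ∞ μ)) {A : Set Ω} {u : Lp W ∞ μ}
    (hu : ∀ᵐ ω ∂μ, ω ∉ A → u ω = 0) : |F u| ≤ ‖u‖ * (dualVariation F A).toReal := by
  have key : ∀ v : Lp W ∞ μ, (∀ᵐ ω ∂μ, ω ∉ A → v ω = 0) →
      F v ≤ ‖v‖ * (dualVariation F A).toReal := by
    intro v hv
    by_cases h0 : ‖v‖ = 0
    · rw [norm_eq_zero.1 h0]
      simp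
    have hpos : 0 < ‖v‖ := lt_of_le_of_ne (norm_nonneg _) (Ne.symm h0)
    have hmem : ‖v‖⁻¹ • v ∈ lpUnitBallOn W μ A := by
      refine ⟨by rw [norm_smul, norm_inv, norm_norm, inv_mul_cancel₀ h0], ?_⟩
      filter_upwards [hv, Lp.coeFn_smul ‖v‖⁻¹ v] with ω h1 h2 h3
      rw [h2, Pi.smul_apply, h1 h3, smul_zero]
    have h1 := (ENNReal.ofReal_le_iff_le_toReal (dualVariation_ne_top F A)).1
      (ofReal_le_dualVariation F hmem)
    rwa [map_smul, smul_eq_mul, inv_mul_le_iff₀ hpos] at h1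
  refine abs_le'.2 ⟨key u hu, ?_⟩
  have := key (-u) (by
    filter_upwards [hu, Lp.coeFn_neg u] with ω h1 h2 h3
    rw [h2, Pi.neg_apply, h1 h3, neg_zero])
  rwa [map_neg, norm_neg] at this

/-- In the sup norm, a sum of two unit-ball functions with disjoint supports stays in the unit ball.
A member with negative value contributes 0 and can be dropped. -/
theorem dualVariation_add_le (F : StrongDual ℝ (Lp W ∞ μ)) {A B C : Set Ω} (hAB : Disjoint A B)
    (hA : A ⊆ C) (hB : B ⊆ C) : dualVariation F A + dualVariation F B ≤ dualVariation F C := by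
  refine ENNReal.iSup_add_iSup_le fun ⟨u, hu1, hu2⟩ ⟨v, hv1, hv2⟩ => ?_
  have hu : u ∈ lpUnitBallOn W μ C := ⟨hu1, hu2.mono fun _ h1 h2 => h1 fun h3 => h2 (hA h3)⟩
  have hv : v ∈ lpUnitBallOn W μ C := ⟨hv1, hv2.mono fun _ h1 h2 => h1 fun h3 => h2 (hB h3)⟩
  have huv : u + v ∈ lpUnitBallOn W μ C := by
    refine ⟨Lp.norm_le_of_ae_norm_le zero_le_one ?_, ?_⟩
    · filter_upwards [Lp.coeFn_add u v, hu2, hv2, Lp.ae_norm_le_norm u, Lp.ae_norm_le_norm v]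
        with ω h1 h2 h3 h4 h5
      rw [h1, Pi.add_apply]
      by_cases hω : ω ∈ A
      · rw [h3 (disjoint_left.1 hAB hω), add_zero]
        exact h4.trans hu1
      · rw [h2 hω, zero_add]
        exact h5.trans hv1
    · filter_upwards [Lp.coeFn_add u v, hu.2, hv.2] with ω h1 h2 h3 h4
      rw [h1, Pi.add_apply, h2 h4, h3 h4, add_zero]
  rcases le_total (F u) 0 with h | h
  · simpa [ENNReal.ofReal_of_nonpos h] using ofReal_le_dualVariation F hv
  rcases le_total (F v) 0 with h' | h'
  · simpa [ENNReal.ofReal_of_nonpos h'] using ofReal_le_dualVariation F hu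
  rw [← ENNReal.ofReal_add h h', ← map_add]
  exact ofReal_le_dualVariation F huv

/-- Split u into its parts on `A` and off `A`. Together with superadditivity this makes the
variation finitely additive on measurable sets; countable additivity may fail. -/
theorem dualVariation_union_le (F : StrongDual ℝ (Lp W ∞ μ)) {A : Set Ω} (hA : MeasurableSet A)
    (B : Set Ω) : dualVariation F (A ∪ B) ≤ dualVariation F A + dualVariation F B := by
  refine iSup_le fun ⟨u, hu1, hu2⟩ => ?_
  have h1 : lpCut A hA u ∈ lpUnitBallOn W μ A :=
    ⟨(norm_lpCut_le A hA u).trans hu1, lpCut_eq_zero_of_notMem A hA u⟩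
  have h2 : lpCut Aᶜ hA.compl u ∈ lpUnitBallOn W μ B := by
    refine ⟨(norm_lpCut_le _ _ u).trans hu1, ?_⟩
    filter_upwards [hu2, coeFn_lpCut Aᶜ hA.compl u] with ω h1 h2 h3
    rw [h2]
    by_cases hω : ω ∈ A
    · exact indicator_of_notMem (by simpa using hω) _
    · rw [indicator_of_mem (by simpa using hω), h1 (by simp [hω, h3])]
  calc ENNReal.ofReal (F u)
      = ENNReal.ofReal (F (lpCut A hA u) + F (lpCut Aᶜ hA.compl u)) := by
        rw [← map_add, lpCut_add_lpCut_compl]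
    _ ≤ _ := ENNReal.ofReal_add_le
    _ ≤ _ := add_le_add (ofReal_le_dualVariation F h1) (ofReal_le_dualVariation F h2)

theorem dualVariation_biUnion_le (F : StrongDual ℝ (Lp W ∞ μ)) {t : ℕ → Set Ω}
    (ht : ∀ i, MeasurableSet (t i)) (n : ℕ) :
    dualVariation F (⋃ i ∈ Finset.range n, t i) ≤ ∑ i ∈ Finset.range n, dualVariation F (t i) := by
  induction n with
  | zero => simp [dualVariation_of_null]
  | succ n ih =>
    rw [Finset.sum_range_succ, Finset.range_add_one, Finset.set_biUnion_insert, add_comm]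
    exact (dualVariation_union_le F (ht n) _).trans (by gcongr)

/-- The countably additive part of the variation, as an outer measure. -/
noncomputable def dualOuterMeasure (F : StrongDual ℝ (Lp W ∞ μ)) : OuterMeasure Ω :=
  OuterMeasure.ofFunction (fun A => ⨅ _ : MeasurableSet A, dualVariation F A)
    (by simp [dualVariation_of_null])

/-- Carathéodory's condition reduces to superadditivity on the two pieces of a measurable test set;
nonmeasurable sets carry the value ⊤ and impose nothing. -/
theorem le_caratheodory_dualOuterMeasure (F : StrongDual ℝ (Lp W ∞ μ)) :
    ‹MeasurableSpace Ω› ≤ (dualOuterMeasure F).caratheodory := fun s hs => by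
  refine OuterMeasure.ofFunction_caratheodory fun t => le_iInf fun ht => ?_
  rw [iInf_pos (ht.inter hs), iInf_pos (ht.diff hs)]
  exact dualVariation_add_le F (disjoint_sdiff_right.mono_left inter_subset_right) inter_subset_left sdiff_subset

/-- The countably additive part of the variation. -/
noncomputable def dualMeasure (F : StrongDual ℝ (Lp W ∞ μ)) : Measure Ω :=
  (dualOuterMeasure F).toMeasure (le_caratheodory_dualOuterMeasure F)

theorem dualMeasure_le (F : StrongDual ℝ (Lp W ∞ μ)) {A : Set Ω} (hA : MeasurableSet A) :
    dualMeasure F A ≤ dualVariation F A := by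
  rw [dualMeasure, toMeasure_apply _ _ hA]
  exact (OuterMeasure.ofFunction_le A).trans (iInf_le _ hA)

instance (F : StrongDual ℝ (Lp W ∞ μ)) : IsFiniteMeasure (dualMeasure F) :=
  ⟨(dualMeasure_le F MeasurableSet.univ).trans_lt (dualVariation_ne_top F _).lt_top⟩

theorem dualMeasure_absolutelyContinuous (F : StrongDual ℝ (Lp W ∞ μ)) : dualMeasure F ≪ μ :=
  Measure.AbsolutelyContinuous.mk fun _ hA h =>
    le_antisymm ((dualMeasure_le F hA).trans (dualVariation_of_null F h).le) zero_le

/-- Take a countable cover whose total variation nearly attains the mass of `dualMeasure`. A finite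
union `D` of its members has variation at most that mass plus ε, and misses little of both measures.
Subtracting the part on `D \ A`, where the variation dominates the measure, leaves an error of 2ε on
`A`. -/
theorem exists_dualVariation_le_dualMeasure_add [IsFiniteMeasure μ] (F : StrongDual ℝ (Lp W ∞ μ))
    {ε : ℝ≥0∞} (hε : ε ≠ 0) :
    ∃ D, MeasurableSet D ∧ μ Dᶜ ≤ ε ∧
      ∀ A, MeasurableSet A → A ⊆ D → dualVariation F A ≤ dualMeasure F A + (ε + ε) := by
  have hlt : dualMeasure F univ < dualMeasure F univ + ε :=
    ENNReal.lt_add_right (measure_ne_top _ _) hε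
  obtain ⟨t, htc, ht⟩ : ∃ t : ℕ → Set Ω, univ ⊆ ⋃ i, t i ∧
      ∑' i, ⨅ _ : MeasurableSet (t i), dualVariation F (t i) < dualMeasure F univ + ε := by
    have heq : dualMeasure F univ = ⨅ (t : ℕ → Set Ω) (_ : univ ⊆ iUnion t),
        ∑' i, ⨅ _ : MeasurableSet (t i), dualVariation F (t i) := by
      rw [dualMeasure, toMeasure_apply _ _ MeasurableSet.univ, dualOuterMeasure,
        OuterMeasure.ofFunction_apply]
    conv_lhs at hlt => rw [heq]
    obtain ⟨t, ht⟩ := iInf_lt_iff.1 hlt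
    obtain ⟨ht1, ht2⟩ := iInf_lt_iff.1 ht
    exact ⟨t, ht1, ht2⟩
  -- A nonmeasurable member would contribute an empty infimum, ⊤, to a finite sum.
  have hm : ∀ i, MeasurableSet (t i) := by
    intro i
    by_contra hi
    have h1 := ENNReal.le_tsum (f := fun i => ⨅ _ : MeasurableSet (t i), dualVariation F (t i)) i
    rw [iInf_neg hi, top_le_iff] at h1
    rw [h1] at ht
    exact not_top_lt ht
  simp_rw [iInf_pos (hm _)] at ht
  set D : ℕ → Set Ω := fun n => ⋃ i ∈ Finset.range n, t i with hD
  have hDm : ∀ n, MeasurableSet (D n) := fun n =>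
    Finset.measurableSet_biUnion _ fun i _ => hm i
  have hDanti : Antitone fun n => (D n)ᶜ := fun a b hab => compl_subset_compl.2 <|
    biUnion_subset_biUnion_left fun i hi => by
      simp only [SetLike.mem_coe, Finset.mem_range] at hi ⊢
      exact hi.trans_le hab
  have hDempty : ⋂ n, (D n)ᶜ = ∅ := by
    rw [← compl_iUnion, compl_empty_iff, eq_univ_iff_forall]
    intro ω
    obtain ⟨i, hi⟩ := mem_iUnion.1 (htc (mem_univ ω))
    exact mem_iUnion.2 ⟨i + 1, mem_biUnion (by simp) hi⟩
  have hlim : ∀ ν : Measure Ω, IsFiniteMeasure ν → ∀ᶠ n in atTop, ν (D n)ᶜ ≤ ε := by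
    intro ν _
    have h := tendsto_measure_iInter_atTop (μ := ν)
      (fun n => (hDm n).compl.nullMeasurableSet) hDanti ⟨0, measure_ne_top _ _⟩
    rw [hDempty, measure_empty] at h
    exact h.eventually_le_const hε.bot_lt
  obtain ⟨n, hn1, hn2⟩ := ((hlim μ inferInstance).and
    (hlim (dualMeasure F) inferInstance)).exists
  refine ⟨D n, hDm n, hn1, fun A hA hAD => ?_⟩
  have h1 : dualVariation F A + dualMeasure F (D n \ A) ≤ dualMeasure F univ + ε :=
    calc _ ≤ dualVariation F A + dualVariation F (D n \ A) := by
          gcongr; exact dualMeasure_le F ((hDm n).diff hA)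
      _ ≤ dualVariation F (D n) := dualVariation_add_le F disjoint_sdiff_right hAD sdiff_subset
      _ ≤ ∑ i ∈ Finset.range n, dualVariation F (t i) := dualVariation_biUnion_le F hm n
      _ ≤ _ := (ENNReal.sum_le_tsum _).trans ht.le
  have h2 : dualMeasure F univ ≤ dualMeasure F A + dualMeasure F (D n \ A) + ε := by
    rw [← measure_add_measure_compl (hDm n), ← measure_inter_add_sdiff (D n) hA,
      inter_eq_self_of_subset_right hAD]
    gcongr
  have h3 : dualVariation F A + dualMeasure F (D n \ A)
      ≤ dualMeasure F A + (ε + ε) + dualMeasure F (D n \ A) :=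
    h1.trans ((add_le_add_left h2 ε).trans_eq (by ring))
  exact (ENNReal.add_le_add_iff_right (measure_ne_top _ _)).1 h3

/-- Away from sets of small measure, the variation of a functional on `L^∞` is dominated by a
countably additive measure. -/
theorem exists_dualVariation_le_dualMeasure [IsFiniteMeasure μ] (F : StrongDual ℝ (Lp W ∞ μ)) :
    ∃ E : ℕ → Set Ω, (∀ n, MeasurableSet (E n)) ∧ Monotone E ∧ (∀ᵐ ω ∂μ, ∃ n, ω ∈ E n) ∧
      ∀ n A, MeasurableSet A → A ⊆ E n → dualVariation F A ≤ dualMeasure F A := by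
  have hpos : ∀ k : ℕ, (2⁻¹ : ℝ≥0∞) ^ k ≠ 0 := fun k => pow_ne_zero _ (by simp)
  choose D hDm hDμ hDF using fun k => exists_dualVariation_le_dualMeasure_add F (hpos k)
  -- Tail intersections exhaust Ω almost everywhere by Borel-Cantelli. On the n-th one the error
  -- bounds for all k ≥ n hold at once, so the error disappears in the limit.
  refine ⟨fun n => ⋂ k ≥ n, D k, fun n => MeasurableSet.biInter (to_countable _) fun k _ => hDm k,
    fun a b hab => biInter_subset_biInter_left fun k hk => le_trans hab hk, ?_, ?_⟩
  · have hsum : ∑' k, μ (D k)ᶜ ≠ ∞ := by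
      refine ne_top_of_le_ne_top ?_ (ENNReal.tsum_le_tsum hDμ)
      rw [ENNReal.tsum_geometric]
      simp
    filter_upwards [ae_eventually_notMem hsum] with ω hω
    obtain ⟨n, hn⟩ := eventually_atTop.1 hω
    exact ⟨n, mem_iInter₂.2 fun k hk => by simpa using hn k hk⟩
  · intro n A hA hAE
    have h0 : Tendsto (fun k : ℕ => (2⁻¹ : ℝ≥0∞) ^ k) atTop (𝓝 0) :=
      ENNReal.tendsto_pow_atTop_nhds_zero_of_lt_one (by simp)
    have hlim : Tendsto (fun k : ℕ => dualMeasure F A + ((2⁻¹ : ℝ≥0∞) ^ k + (2⁻¹ : ℝ≥0∞) ^ k))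
        atTop (𝓝 (dualMeasure F A + (0 + 0))) := tendsto_const_nhds.add (h0.add h0)
    rw [add_zero, add_zero] at hlim
    refine ge_of_tendsto hlim ?_
    filter_upwards [eventually_ge_atTop n] with k hk
    exact hDF k A hA (hAE.trans (biInter_subset_of_mem hk))

end DualOfLInfty

/-! ### Radon-Nikodym densities with values in a separable dual -/

/-- A map into a separable metric space is measurable if its distances to points are. -/
theorem measurable_of_measurable_dist {Ω Y : Type*} [MeasurableSpace Ω] [PseudoMetricSpace Y]
    [TopologicalSpace.SeparableSpace Y] [MeasurableSpace Y] [BorelSpace Y] {l : Ω → Y}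
    (h : ∀ y, Measurable fun ω => dist (l ω) y) : Measurable l := by
  have := UniformSpace.secondCountable_of_separable Y
  refine measurable_of_isOpen fun U hU => ?_
  choose ε hε hεU using fun y : U => Metric.isOpen_iff.1 hU y y.2
  have hUeq : U = ⋃ y : U, Metric.ball (y : Y) (ε y) :=
    Subset.antisymm (fun y hy => mem_iUnion.2 ⟨⟨y, hy⟩, Metric.mem_ball_self (hε _)⟩)
      (iUnion_subset hεU)
  obtain ⟨T, hT, hTU⟩ := TopologicalSpace.isOpen_iUnion_countable
    (fun y : U => Metric.ball (y : Y) (ε y)) fun _ => Metric.isOpen_ball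
  rw [hUeq, ← hTU, preimage_iUnion₂]
  exact MeasurableSet.biUnion hT fun y _ => h y measurableSet_Iio

theorem ContinuousLinearMap.opNorm_le_of_dense {E : Type*} [NormedAddCommGroup E]
    [NormedSpace ℝ E] {D : Set E} (hD : Dense D) (f : StrongDual ℝ E) {C : ℝ} (hC : 0 ≤ C)
    (h : ∀ d ∈ D, |f d| ≤ C * ‖d‖) : ‖f‖ ≤ C := by
  refine f.opNorm_le_bound hC fun x => ?_
  have hcl : IsClosed {x | ‖f x‖ ≤ C * ‖x‖} := isClosed_le (by fun_prop) (by fun_prop)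
  exact hcl.closure_subset_iff.2 (fun d hd => h d hd) (hD x)

section RadonNikodym

variable {Ω W : Type*} [MeasurableSpace Ω] {μ ρ : Measure Ω} [IsFiniteMeasure μ]
  [NormedAddCommGroup W] [NormedSpace ℝ W]

/-- Scalar densities of a dual-valued measure. -/
theorem exists_scalar_density (hρμ : ρ ≪ μ) (N : VectorMeasure Ω (StrongDual ℝ W))
    (hN : ∀ s, ‖N s‖ₑ ≤ ρ s) (w : W) :
    ∃ h : Ω → ℝ, Measurable h ∧ Integrable h μ ∧
      ∀ s, MeasurableSet s → ∫ ω in s, h ω ∂μ = N s w := by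
  let ν : SignedMeasure Ω := N.mapRange
    (ContinuousLinearMap.apply ℝ ℝ w : StrongDual ℝ W →L[ℝ] ℝ).toLinearMap.toAddMonoidHom
    (ContinuousLinearMap.apply ℝ ℝ w : StrongDual ℝ W →L[ℝ] ℝ).continuous
  have hν : ν ≪ᵥ μ.toENNRealVectorMeasure := by
    refine VectorMeasure.AbsolutelyContinuous.mk fun s hs h => ?_
    rw [Measure.toENNRealVectorMeasure_apply_measurable hs] at h
    have h1 : N s = 0 := by
      have := hN s
      rw [hρμ h, nonpos_iff_eq_zero] at this
      rw [← norm_eq_zero, ← toReal_enorm, this, ENNReal.toReal_zero]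
    change N s w = 0
    rw [h1, _root_.zero_apply]
  refine ⟨ν.rnDeriv μ, ν.measurable_rnDeriv μ, ν.integrable_rnDeriv μ, fun s hs => ?_⟩
  rw [← withDensityᵥ_apply (ν.integrable_rnDeriv μ) hs, ν.withDensityᵥ_rnDeriv_eq μ hν]
  rfl

/-- The Radon-Nikodym theorem for measures with values in a separable dual space. -/
theorem exists_dual_density [IsFiniteMeasure ρ] [TopologicalSpace.SeparableSpace W]
    [TopologicalSpace.SeparableSpace (StrongDual ℝ W)] (hρμ : ρ ≪ μ)
    (N : VectorMeasure Ω (StrongDual ℝ W)) (hN : ∀ s, ‖N s‖ₑ ≤ ρ s) :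
    ∃ l : Ω → StrongDual ℝ W, StronglyMeasurable l ∧
      (∀ᵐ ω ∂μ, ‖l ω‖ ≤ (ρ.rnDeriv μ ω).toReal) ∧
      ∀ s, MeasurableSet s → N s = ∫ ω in s, l ω ∂μ := by
  obtain ⟨D, hDc, hD⟩ := exists_countable_dense_addSubgroup W
  choose h hm hi hs using exists_scalar_density hρμ N hN
  set k : Ω → ℝ := fun ω => (ρ.rnDeriv μ ω).toReal with hk
  have hkm : Measurable k := (Measure.measurable_rnDeriv ρ μ).ennreal_toReal
  have hki : Integrable k μ := Measure.integrable_toReal_rnDeriv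
  have hNr : ∀ s w, |N s w| ≤ ‖w‖ * ρ.real s := by
    intro s w
    have h1 : ‖N s‖ ≤ ρ.real s := by
      rw [← toReal_enorm]
      exact ENNReal.toReal_mono (measure_ne_top _ _) (hN s)
    exact ((N s).le_opNorm w).trans (by rw [mul_comm]; gcongr)
  have hksum : ∀ (w : W) (s : Set Ω), ∫ ω in s, ‖w‖ * k ω ∂μ = ‖w‖ * ρ.real s := by
    intro w s
    rw [integral_const_mul, Measure.setIntegral_toReal_rnDeriv hρμ s]
  have hbound : ∀ w, ∀ᵐ ω ∂μ, |h w ω| ≤ k ω * ‖w‖ := by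
    intro w
    have h1 : h w ≤ᵐ[μ] fun ω => ‖w‖ * k ω :=
      ae_le_of_forall_setIntegral_le (hi w) (hki.const_mul _) fun s hsm _ => by
        rw [hs w s hsm, hksum]
        exact (le_abs_self _).trans (hNr s w)
    have h2 : (fun ω => -h w ω) ≤ᵐ[μ] fun ω => ‖w‖ * k ω :=
      ae_le_of_forall_setIntegral_le (hi w).neg (hki.const_mul _) fun s hsm _ => by
        rw [integral_neg, hs w s hsm, hksum]
        exact (neg_le_abs _).trans (hNr s w)
    filter_upwards [h1, h2] with ω h1 h2
    rw [mul_comm]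
    exact abs_le'.2 ⟨h1, h2⟩
  have hadd : ∀ w w', ∀ᵐ ω ∂μ, h (w + w') ω = h w ω + h w' ω := by
    intro w w'
    refine Integrable.ae_eq_of_forall_setIntegral_eq _ _ (hi _) ((hi w).add (hi w'))
      fun s hsm _ => ?_
    rw [integral_add (hi w).integrableOn (hi w').integrableOn, hs _ s hsm, hs _ s hsm,
      hs _ s hsm, map_add]
  -- Each relation holds almost everywhere for fixed vectors. Restricting to the countable subgroup
  -- `D` leaves one exceptional null set, off which the scalar densities extend to a functional.
  set G : Set Ω := {ω | (∀ d d' : D, h (d + d') ω = h d ω + h d' ω) ∧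
    ∀ d : D, |h d ω| ≤ k ω * ‖(d : W)‖} with hG
  have hGm : MeasurableSet G := by
    have hGeq : G = (⋂ (d : D) (d' : D), {ω | h (d + d') ω = h d ω + h d' ω}) ∩
        ⋂ d : D, {ω | |h d ω| ≤ k ω * ‖(d : W)‖} := by
      ext ω
      simp [hG]
    rw [hGeq]
    exact (MeasurableSet.iInter fun d => MeasurableSet.iInter fun d' =>
      measurableSet_eq_fun (hm _) ((hm _).add (hm _))).inter
      (MeasurableSet.iInter fun d => measurableSet_le (hm _).abs (hkm.mul_const _))
  have hGae : ∀ᵐ ω ∂μ, ω ∈ G := by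
    filter_upwards [ae_all_iff.2 fun d : D => ae_all_iff.2 fun d' : D => hadd d d',
      ae_all_iff.2 fun d : D => hbound d] with ω h1 h2
    exact ⟨h1, h2⟩
  have hex : ∀ ω, ∃ f : StrongDual ℝ W, (∀ d : D, f d = G.indicator (h d) ω) ∧ ‖f‖ ≤ k ω := by
    intro ω
    by_cases hω : ω ∈ G
    · obtain ⟨f, hf, hfk⟩ := exists_dual_extension_of_dense hD
        (AddMonoidHom.mk' (fun d : D => h d ω) hω.1) (C := k ω) ENNReal.toReal_nonneg hω.2
      exact ⟨f, fun d => by rw [hf, indicator_of_mem hω]; rfl, hfk⟩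
    · exact ⟨0, fun d => by rw [indicator_of_notMem hω]; rfl, by
        rw [norm_zero]; exact ENNReal.toReal_nonneg⟩
  choose l hl hlk using hex
  have hlm : StronglyMeasurable l := by
    let : MeasurableSpace (StrongDual ℝ W) := borel _
    have : BorelSpace (StrongDual ℝ W) := ⟨rfl⟩
    have := UniformSpace.secondCountable_of_separable (StrongDual ℝ W)
    refine Measurable.stronglyMeasurable (measurable_of_measurable_dist fun f => ?_)
    refine measurable_of_Iic fun r => ?_
    rcases lt_or_ge r 0 with hr | hr
    · convert MeasurableSet.empty
      ext ω
      simpa using hr.trans_le dist_nonneg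
    -- The operator norm is tested on the countable dense `D`, so the preimage is a countable
    -- intersection of scalar conditions.
    have : (fun ω => dist (l ω) f) ⁻¹' Iic r
        = ⋂ d : D, {ω | |G.indicator (h d) ω - f d| ≤ r * ‖(d : W)‖} := by
      ext ω
      simp only [mem_preimage, mem_Iic, mem_iInter, mem_ofPred_eq, ← hl, dist_eq_norm]
      constructor
      · intro hr d
        have h1 := (l ω - f).le_opNorm d
        exact h1.trans (by gcongr)
      · exact fun h1 => ContinuousLinearMap.opNorm_le_of_dense hD _ hr fun d hd => h1 ⟨d, hd⟩
    rw [this]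
    exact MeasurableSet.iInter fun d =>
      measurableSet_le (((hm _).indicator hGm).sub measurable_const).abs measurable_const
  have hli : Integrable l μ := hki.mono' hlm.aestronglyMeasurable (Eventually.of_forall hlk)
  refine ⟨l, hlm, Eventually.of_forall hlk, fun s hsm => ?_⟩
  have heq : (N s : W → ℝ) = (∫ ω in s, l ω ∂μ : StrongDual ℝ W) := by
    refine Continuous.ext_on hD (N s).continuous (ContinuousLinearMap.continuous _) ?_
    intro d hd
    rw [ContinuousLinearMap.integral_apply hli.integrableOn, ← hs d s hsm]
    refine setIntegral_congr_ae hsm ?_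
    filter_upwards [hGae] with ω hω _
    rw [hl ω ⟨d, hd⟩, indicator_of_mem hω]
  exact DFunLike.coe_injective heq

end RadonNikodym

/-! ### Integral representation of functionals on L^∞ over large sets -/

theorem aestronglyMeasurable_dual_apply {Ω W : Type*} [MeasurableSpace Ω] {μ : Measure Ω}
    [NormedAddCommGroup W] [NormedSpace ℝ W] {l : Ω → StrongDual ℝ W} {u : Ω → W}
    (hl : AEStronglyMeasurable l μ) (hu : AEStronglyMeasurable u μ) :
    AEStronglyMeasurable (fun ω => l ω (u ω)) μ :=
  (ContinuousLinearMap.id ℝ (StrongDual ℝ W)).aestronglyMeasurable_comp₂ hl hu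

theorem integrable_dual_apply {Ω W : Type*} [MeasurableSpace Ω] {μ : Measure Ω}
    [NormedAddCommGroup W] [NormedSpace ℝ W] {l : Ω → StrongDual ℝ W} (hl : Integrable l μ) (u : Lp W ∞ μ) :
    Integrable (fun ω => l ω (u ω)) μ := by
  refine (hl.norm.mul_const ‖u‖).mono'
    (aestronglyMeasurable_dual_apply hl.1 (Lp.aestronglyMeasurable u)) ?_
  filter_upwards [Lp.ae_norm_le_norm u] with ω hω
  exact (l ω).le_opNorm_of_le hω

section LOneRepresentation

variable {Ω W : Type*} [MeasurableSpace Ω] {μ : Measure Ω} [IsFiniteMeasure μ]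
  [NormedAddCommGroup W]

theorem norm_indicatorConstLp_top_le {s : Set Ω} (hs : MeasurableSet s) (w : W) :
    ‖indicatorConstLp ∞ hs (measure_ne_top μ s) w‖ ≤ ‖w‖ := by
  refine Lp.norm_le_of_ae_norm_le (norm_nonneg _) ?_
  filter_upwards [indicatorConstLp_coeFn (p := ∞) (hs := hs) (hμs := measure_ne_top μ s) (c := w)]
    with ω h
  rw [h]
  exact norm_indicator_le_norm_self _ _

/-- A countably additive functional on `L^∞` is determined by its values on indicators. -/
theorem eq_zero_of_indicatorConstLp_eq_zero {ρ : Measure Ω} [IsFiniteMeasure ρ]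
    (T : Lp W ∞ μ →+ ℝ)
    (hT : ∀ u B, MeasurableSet B → (∀ᵐ ω ∂μ, ω ∉ B → u ω = 0) → |T u| ≤ ‖u‖ * ρ.real B)
    (h0 : ∀ s (hs : MeasurableSet s) w, T (indicatorConstLp ∞ hs (measure_ne_top μ s) w) = 0)
    (u : Lp W ∞ μ) : T u = 0 := by
  have hsimple : ∀ s : SimpleFunc Ω W, T ((s.memLp_top μ).toLp s) = 0 := by
    intro s
    induction s using SimpleFunc.induction with
    | const c hs =>
      rw [← h0 _ hs c]
      congr 1
    | @add f g _ hf hg =>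
      have : ((f + g).memLp_top μ).toLp (f + g : SimpleFunc Ω W)
          = (f.memLp_top μ).toLp f + (g.memLp_top μ).toLp g := rfl
      rw [this, map_add, hf, hg, add_zero]
  have hsm := Lp.stronglyMeasurable u
  have key : ∀ ε : ℝ, 0 < ε → |T u| ≤ ε * (‖u‖ + ρ.real univ) := by
    intro ε hε
    -- Simple functions need not be norm dense in L^∞ with values in W. Egorov's theorem for ρ gives
    -- uniform approximation off a set t of small ρ-measure, and `hT` makes the part on t
    -- negligible.
    obtain ⟨t, ht, htε, hunif⟩ := tendstoUniformlyOn_of_ae_tendsto' (μ := ρ)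
      (fun n => (hsm.approx n).stronglyMeasurable) hsm
      (Eventually.of_forall hsm.tendsto_approx) hε
    obtain ⟨n, hn⟩ := (Metric.tendstoUniformlyOn_iff.1 hunif ε hε).exists
    set s := (hsm.approx n).restrict tᶜ
    have h1 : |T (lpCut t ht u)| ≤ ‖u‖ * ε := by
      refine (hT _ t ht (lpCut_eq_zero_of_notMem t ht u)).trans ?_
      gcongr
      · exact norm_lpCut_le t ht u
      · exact ENNReal.toReal_le_of_le_ofReal hε.le htε
    have h2 : |T (lpCut tᶜ ht.compl u - (s.memLp_top μ).toLp s)| ≤ ε * ρ.real univ := by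
      refine (hT _ univ MeasurableSet.univ (by simp)).trans ?_
      gcongr
      refine Lp.norm_le_of_ae_norm_le hε.le ?_
      filter_upwards [Lp.coeFn_sub (lpCut tᶜ ht.compl u) ((s.memLp_top μ).toLp s),
        coeFn_lpCut tᶜ ht.compl u, MemLp.coeFn_toLp (s.memLp_top μ)] with ω h1 h2 h3
      rw [h1, Pi.sub_apply, h2, h3, SimpleFunc.restrict_apply _ ht.compl]
      by_cases hω : ω ∈ tᶜ
      · rw [indicator_of_mem hω, indicator_of_mem hω, ← dist_eq_norm]
        exact (hn ω hω).le
      · rw [indicator_of_notMem hω, indicator_of_notMem hω, sub_zero, norm_zero]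
        exact hε.le
    rw [map_sub, hsimple, sub_zero] at h2
    rw [← lpCut_add_lpCut_compl t ht u, map_add, lpCut_add_lpCut_compl]
    refine (abs_add_le _ _).trans ((add_le_add h1 h2).trans_eq (by ring))
  have hlim : Tendsto (fun ε : ℝ => ε * (‖u‖ + ρ.real univ)) (𝓝[>] 0) (𝓝 0) := by
    have : Tendsto (fun ε : ℝ => ε * (‖u‖ + ρ.real univ)) (𝓝 0) (𝓝 (0 * (‖u‖ + ρ.real univ))) :=
      tendsto_id.mul_const _
    rw [zero_mul] at this
    exact this.mono_left nhdsWithin_le_nhds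
  have := ge_of_tendsto hlim (eventually_mem_nhdsWithin.mono fun ε hε => key ε hε)
  exact abs_nonpos_iff.1 this

variable [NormedSpace ℝ W]

open Classical in
/-- The set function `s ↦ (w ↦ F (w 1_s))` of a functional `F` on `L^∞`. -/
noncomputable def dualSetFunction (F : StrongDual ℝ (Lp W ∞ μ)) (s : Set Ω) : StrongDual ℝ W :=
  if hs : MeasurableSet s then
    F.comp (LinearMap.mkContinuous
      { toFun := fun w => indicatorConstLp ∞ hs (measure_ne_top μ s) w
        map_add' := fun w w' => indicatorConstLp_add.symm
        map_smul' := fun c w => by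
          apply Lp.ext
          filter_upwards [indicatorConstLp_coeFn (p := ∞) (hs := hs)
            (hμs := measure_ne_top μ s) (c := c • w), indicatorConstLp_coeFn (p := ∞) (hs := hs)
            (hμs := measure_ne_top μ s) (c := w), Lp.coeFn_smul c
            (indicatorConstLp ∞ hs (measure_ne_top μ s) w)] with ω h1 h2 h3
          rw [h1, RingHom.id_apply, h3, Pi.smul_apply, h2]
          by_cases hω : ω ∈ s <;> simp [hω] } 1
      fun w => by simpa using! norm_indicatorConstLp_top_le hs w)
  else 0

theorem dualSetFunction_apply (F : StrongDual ℝ (Lp W ∞ μ)) {s : Set Ω} (hs : MeasurableSet s)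
    (w : W) : dualSetFunction F s w = F (indicatorConstLp ∞ hs (measure_ne_top μ s) w) := by
  rw [dualSetFunction, dif_pos hs]
  rfl

theorem dualSetFunction_union (F : StrongDual ℝ (Lp W ∞ μ)) {s t : Set Ω} (hs : MeasurableSet s)
    (ht : MeasurableSet t) (hst : Disjoint s t) :
    dualSetFunction F (s ∪ t) = dualSetFunction F s + dualSetFunction F t := by
  ext w
  rw [_root_.add_apply, dualSetFunction_apply F hs, dualSetFunction_apply F ht,
    dualSetFunction_apply F (hs.union ht), ← map_add,
    indicatorConstLp_disjoint_union hs ht (measure_ne_top μ s) (measure_ne_top μ t) hst]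

theorem norm_dualSetFunction_le (F : StrongDual ℝ (Lp W ∞ μ)) {s : Set Ω} (hs : MeasurableSet s)
    (h : dualVariation F s ≤ dualMeasure F s) : ‖dualSetFunction F s‖ ≤ (dualMeasure F).real s := by
  refine ContinuousLinearMap.opNorm_le_bound _ ENNReal.toReal_nonneg fun w => ?_
  rw [dualSetFunction_apply F hs, mul_comm]
  refine (abs_le_norm_mul_dualVariation F (A := s) ?_).trans ?_
  · exact indicatorConstLp_coeFn_notMem
  · gcongr
    · exact norm_indicatorConstLp_top_le hs w
    · exact ENNReal.toReal_mono (measure_ne_top _ _) h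

/-- The countably additive part of a functional on `L^∞`. -/
theorem exists_vectorMeasure_eq_on (F : StrongDual ℝ (Lp W ∞ μ)) {E : ℕ → Set Ω}
    (hEm : ∀ n, MeasurableSet (E n)) (hE : Monotone E) (hEae : ∀ᵐ ω ∂μ, ∃ n, ω ∈ E n)
    (hEF : ∀ n A, MeasurableSet A → A ⊆ E n → dualVariation F A ≤ dualMeasure F A) :
    ∃ N : VectorMeasure Ω (StrongDual ℝ W), (∀ s, ‖N s‖ₑ ≤ dualMeasure F s) ∧
      ∀ n s, MeasurableSet s → s ⊆ E n → N s = dualSetFunction F s := by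
  have hlim0 : Tendsto (fun n => (dualMeasure F).real (E n)ᶜ) atTop (𝓝 0) := by
    have h := tendsto_measure_iInter_atTop (μ := dualMeasure F)
      (fun n => (hEm n).compl.nullMeasurableSet) (fun a b hab => compl_subset_compl.2 (hE hab))
      ⟨0, measure_ne_top _ _⟩
    have h0 : dualMeasure F (⋂ n, (E n)ᶜ) = 0 := by
      apply dualMeasure_absolutelyContinuous F
      rw [← compl_iUnion, ← mem_ae_iff]
      filter_upwards [hEae] with ω hω
      exact mem_iUnion.2 hω
    rw [h0] at h
    exact (ENNReal.tendsto_toReal ENNReal.zero_ne_top).comp h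
  have hconv : ∀ s, MeasurableSet s →
      ∃ L, Tendsto (fun n => dualSetFunction F (s ∩ E n)) atTop (𝓝 L) := by
    intro s hs
    -- Passing from `E n` to `E m` changes the value by at most the measure of the complement of `E
    -- n`, which tends to 0 because `dualMeasure F` is finite and absolutely continuous.
    refine cauchySeq_tendsto_of_complete (cauchySeq_of_le_tendsto_0' _ (fun n m hnm => ?_) hlim0)
    have hsub : s ∩ (E m \ E n) ⊆ E m := inter_subset_right.trans sdiff_subset
    have hm : MeasurableSet (s ∩ (E m \ E n)) := hs.inter ((hEm m).diff (hEm n))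
    have hsplit : s ∩ E m = s ∩ E n ∪ s ∩ (E m \ E n) := by
      rw [← inter_union_distrib_left, union_sdiff_cancel (hE hnm)]
    rw [dist_comm, dist_eq_norm, hsplit, dualSetFunction_union F (hs.inter (hEm n)) hm
      (disjoint_sdiff_right.mono inter_subset_right inter_subset_right), add_sub_cancel_left]
    refine (norm_dualSetFunction_le F hm (hEF m _ hm hsub)).trans (measureReal_mono ?_)
    exact fun ω hω => hω.2.2
  choose! L hL using hconv
  classical
  let N : Set Ω → StrongDual ℝ W := fun s => if MeasurableSet s then L s else 0
  have hNL : ∀ {s}, MeasurableSet s → N s = L s := fun hs => if_pos hs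
  have hN : ∀ s, ‖N s‖ₑ ≤ dualMeasure F s := by
    intro s
    by_cases hs : MeasurableSet s
    · rw [hNL hs]
      refine le_of_tendsto (hL s hs).enorm (Eventually.of_forall fun n => ?_)
      have hm := hs.inter (hEm n)
      rw [← ofReal_norm]
      refine ENNReal.ofReal_le_of_le_toReal
        ((norm_dualSetFunction_le F hm (hEF n _ hm inter_subset_right)).trans ?_)
      exact measureReal_mono inter_subset_left
    · rw [show N s = 0 from if_neg hs, ← ofReal_norm, norm_zero, ENNReal.ofReal_zero]
      exact zero_le
  refine ⟨VectorMeasure.of_additive_of_le_measure N hN (fun s t hs ht hst => ?_)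
    fun s hs => if_neg hs, hN, fun n s hs hsE => ?_⟩
  · rw [hNL hs, hNL ht, hNL (hs.union ht)]
    refine tendsto_nhds_unique (hL _ (hs.union ht)) (((hL s hs).add (hL t ht)).congr fun n => ?_)
    rw [union_inter_distrib_right, dualSetFunction_union F (hs.inter (hEm n)) (ht.inter (hEm n))
      (hst.mono inter_subset_left inter_subset_left)]
  · change N s = _
    rw [hNL hs]
    refine tendsto_nhds_unique (hL s hs) (tendsto_const_nhds.congr' ?_)
    filter_upwards [eventually_ge_atTop n] with m hm
    rw [inter_eq_self_of_subset_left (hsE.trans (hE hm))]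

/-- A functional on `L^∞` is represented by an integrable density on large sets. -/
theorem exists_integrable_density [TopologicalSpace.SeparableSpace W]
    [TopologicalSpace.SeparableSpace (StrongDual ℝ W)] (F : StrongDual ℝ (Lp W ∞ μ)) :
    ∃ l : Lp (StrongDual ℝ W) 1 μ, ∃ E : ℕ → Set Ω, (∀ n, MeasurableSet (E n)) ∧ Monotone E ∧
      (∀ᵐ ω ∂μ, ∃ n, ω ∈ E n) ∧ ∀ n, ∀ u : Lp W ∞ μ, (∀ᵐ ω ∂μ, ω ∉ E n → u ω = 0) →
        F u = ∫ ω, l ω (u ω) ∂μ := by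
  obtain ⟨E, hEm, hE, hEae, hEF⟩ := exists_dualVariation_le_dualMeasure F
  obtain ⟨N, hN, hNF⟩ := exists_vectorMeasure_eq_on F hEm hE hEae hEF
  have hρμ := dualMeasure_absolutelyContinuous F
  obtain ⟨l, hlm, hlk, hlN⟩ := exists_dual_density hρμ N hN
  have hki : Integrable (fun ω => ((dualMeasure F).rnDeriv μ ω).toReal) μ :=
    Measure.integrable_toReal_rnDeriv
  have hli : Integrable l μ := hki.mono' hlm.aestronglyMeasurable hlk
  have hl1 : MemLp l 1 μ := memLp_one_iff_integrable.2 hli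
  refine ⟨hl1.toLp l, E, hEm, hE, hEae, fun n u hu => ?_⟩
  -- The defect between F and its candidate density on `E n`. It vanishes on indicators by
  -- construction of the density.
  let T : Lp W ∞ μ →+ ℝ := AddMonoidHom.mk'
    (fun v => F (lpCut (E n) (hEm n) v) - ∫ ω in E n, l ω (v ω) ∂μ) fun v v' => by
      have h1 : lpCut (E n) (hEm n) (v + v')
          = lpCut (E n) (hEm n) v + lpCut (E n) (hEm n) v' := by
        apply Lp.ext
        filter_upwards [coeFn_lpCut (E n) (hEm n) (v + v'), coeFn_lpCut (E n) (hEm n) v,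
          coeFn_lpCut (E n) (hEm n) v', Lp.coeFn_add v v',
          Lp.coeFn_add (lpCut (E n) (hEm n) v) (lpCut (E n) (hEm n) v')] with ω h1 h2 h3 h4 h5
        rw [h1, h5, Pi.add_apply, h2, h3]
        by_cases hω : ω ∈ E n
        · simp only [indicator_of_mem hω, h4, Pi.add_apply]
        · simp only [indicator_of_notMem hω, add_zero]
      have h2 : ∫ ω in E n, l ω ((v + v' : Lp W ∞ μ) ω) ∂μ
          = ∫ ω in E n, (l ω (v ω) + l ω (v' ω)) ∂μ := by
        refine setIntegral_congr_ae (hEm n) ?_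
        filter_upwards [Lp.coeFn_add v v'] with ω h _
        rw [h, Pi.add_apply, map_add]
      rw [h1, h2, map_add, integral_add (integrable_dual_apply hli v).integrableOn
        (integrable_dual_apply hli v').integrableOn]
      ring
  have hT0 : T u = 0 := by
    -- The dominating measure is doubled: one copy for the functional, one for the integral.
    refine eq_zero_of_indicatorConstLp_eq_zero (ρ := dualMeasure F + dualMeasure F) T ?_ ?_ u
    · intro v B hB hv
      have h1 : |F (lpCut (E n) (hEm n) v)| ≤ ‖v‖ * (dualMeasure F).real B := by
        have hm := (hEm n).inter hB
        refine (abs_le_norm_mul_dualVariation F (A := E n ∩ B) ?_).trans ?_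
        · filter_upwards [hv, coeFn_lpCut (E n) (hEm n) v] with ω h1 h2 h3
          rw [h2]
          by_cases hω : ω ∈ E n
          · rw [indicator_of_mem hω, h1 fun h => h3 ⟨hω, h⟩]
          · exact indicator_of_notMem hω _
        · gcongr
          · exact norm_lpCut_le _ _ v
          · exact ENNReal.toReal_mono (measure_ne_top _ _)
              ((hEF n _ hm inter_subset_left).trans (measure_mono inter_subset_right))
      have h2 : |∫ ω in E n, l ω (v ω) ∂μ| ≤ ‖v‖ * (dualMeasure F).real B := by
        rw [← Measure.setIntegral_toReal_rnDeriv hρμ B, ← integral_const_mul,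
          ← integral_indicator (hEm n), ← integral_indicator hB, ← Real.norm_eq_abs]
        refine norm_integral_le_of_norm_le ((hki.const_mul ‖v‖).indicator hB) ?_
        filter_upwards [hv, hlk, Lp.ae_norm_le_norm v] with ω h1 h2 h3
        by_cases hωB : ω ∈ B
        · rw [indicator_of_mem hωB]
          refine (norm_indicator_le_norm_self _ _).trans (((l ω).le_opNorm _).trans ?_)
          rw [mul_comm]
          gcongr
        · rw [indicator_of_notMem hωB, indicator_apply_eq_zero.2 fun _ => by
            rw [h1 hωB, map_zero], norm_zero]
      rw [measureReal_add_apply, mul_add]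
      exact (abs_sub _ _).trans (add_le_add h1 h2)
    · intro s hs w
      have hm := hs.inter (hEm n)
      have h1 : lpCut (E n) (hEm n) (indicatorConstLp ∞ hs (measure_ne_top μ s) w)
          = indicatorConstLp ∞ hm (measure_ne_top μ _) w := by
        apply Lp.ext
        filter_upwards [coeFn_lpCut (E n) (hEm n) (indicatorConstLp ∞ hs (measure_ne_top μ s) w),
          indicatorConstLp_coeFn (p := ∞) (hs := hs) (hμs := measure_ne_top μ s) (c := w),
          indicatorConstLp_coeFn (p := ∞) (hs := hm) (hμs := measure_ne_top μ _) (c := w)]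
          with ω h1 h2 h3
        rw [h1, h3, inter_comm, ← indicator_indicator]
        by_cases hω : ω ∈ E n <;> simp [hω, h2]
      have h2 : ∫ ω in E n, l ω (indicatorConstLp ∞ hs (measure_ne_top μ s) w ω) ∂μ
          = ∫ ω in s ∩ E n, l ω w ∂μ := by
        rw [← integral_indicator (hEm n), ← integral_indicator hm]
        refine integral_congr_ae ?_
        filter_upwards [indicatorConstLp_coeFn (p := ∞) (hs := hs) (hμs := measure_ne_top μ s)
          (c := w)] with ω h
        by_cases hω : ω ∈ E n <;> by_cases hω' : ω ∈ s <;> simp [hω, hω', h]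
      change F _ - ∫ ω in E n, _ ∂μ = 0
      rw [h1, h2, ← dualSetFunction_apply F hm, ← hNF n _ hm inter_subset_right, hlN _ hm,
        ContinuousLinearMap.integral_apply hli.integrableOn, sub_self]
  have hcut : lpCut (E n) (hEm n) u = u := by
    apply Lp.ext
    filter_upwards [hu, coeFn_lpCut (E n) (hEm n) u] with ω h1 h2
    rw [h2]
    by_cases hω : ω ∈ E n
    · rw [indicator_of_mem hω]
    · rw [indicator_of_notMem hω, h1 hω]
  have hint : ∫ ω in E n, l ω (u ω) ∂μ = ∫ ω, hl1.toLp l ω (u ω) ∂μ := by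
    rw [← integral_indicator (hEm n)]
    refine integral_congr_ae ?_
    filter_upwards [hu, hl1.coeFn_toLp] with ω h1 h2
    rw [h2]
    by_cases hω : ω ∈ E n
    · rw [indicator_of_mem hω]
    · rw [indicator_of_notMem hω, h1 hω, map_zero]
  have hT1 : T u = F (lpCut (E n) (hEm n) u) - ∫ ω in E n, l ω (u ω) ∂μ := rfl
  rw [← hint, ← sub_eq_zero, ← hT0, hT1, hcut]

end LOneRepresentation

/-! ### Convexity and closedness of the constraints, bounded feasible points -/

theorem ae_tendsto_of_tendsto_Lp_top {Ω E : Type*} [MeasurableSpace Ω] {μ : Measure Ω}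
    [NormedAddCommGroup E] {f : ℕ → Lp E ∞ μ} {g : Lp E ∞ μ} (h : Tendsto f atTop (𝓝 g)) :
    ∀ᵐ ω ∂μ, Tendsto (fun n => f n ω) atTop (𝓝 (g ω)) := by
  filter_upwards [ae_all_iff.2 fun n => Lp.ae_norm_le_norm (f n - g),
    ae_all_iff.2 fun n => Lp.coeFn_sub (f n) g] with ω h1 h2
  rw [tendsto_iff_norm_sub_tendsto_zero] at h ⊢
  refine squeeze_zero (fun _ => norm_nonneg _) (fun n => ?_) h
  rw [← Pi.sub_apply, ← h2 n]
  exact h1 n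

namespace TwoStageProblem

variable {Ω X₁ X₂ W R : Type*} [MeasurableSpace Ω]
  [NormedAddCommGroup X₁] [NormedSpace ℝ X₁] [NormedAddCommGroup X₂] [NormedSpace ℝ X₂]
  [NormedAddCommGroup W] [NormedSpace ℝ W] [NormedAddCommGroup R] [NormedSpace ℝ R]
  {P : TwoStageProblem Ω X₁ X₂ W R} {μ : Measure Ω}

/-- The graph of the perturbed constraints. -/
def feasibleGraph (P : TwoStageProblem Ω X₁ X₂ W R) (μ : Measure Ω) :
    Set ((X₁ × Lp X₂ ∞ μ) × (Lp W ∞ μ × Lp R ∞ μ)) :=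
  {p | p.1 ∈ P.perturbedAdmissible μ p.2}

theorem convex_feasibleGraph (hP : P.StandingAssumption μ) : Convex ℝ (P.feasibleGraph μ) := by
  -- K-convexity of i is given for weights strictly between 0 and 1 only.
  rw [convex_iff_forall_pos]
  rintro ⟨⟨x, y⟩, u, v⟩ ⟨h1, h2, h3, h4⟩ ⟨⟨x', y'⟩, u', v'⟩ ⟨h1', h2', h3', h4'⟩ a b ha hb hab
  have hy : ∀ᵐ ω ∂μ, (a • y + b • y' : Lp X₂ ∞ μ) ω = a • y ω + b • y' ω := by
    filter_upwards [Lp.coeFn_add (a • y) (b • y'), Lp.coeFn_smul a y, Lp.coeFn_smul b y']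
      with ω h1 h2 h3
    rw [h1, Pi.add_apply, h2, h3, Pi.smul_apply, Pi.smul_apply]
  have hu : ∀ᵐ ω ∂μ, (a • u + b • u' : Lp W ∞ μ) ω = a • u ω + b • u' ω := by
    filter_upwards [Lp.coeFn_add (a • u) (b • u'), Lp.coeFn_smul a u, Lp.coeFn_smul b u']
      with ω h1 h2 h3
    rw [h1, Pi.add_apply, h2, h3, Pi.smul_apply, Pi.smul_apply]
  have hv : ∀ᵐ ω ∂μ, (a • v + b • v' : Lp R ∞ μ) ω = a • v ω + b • v' ω := by
    filter_upwards [Lp.coeFn_add (a • v) (b • v'), Lp.coeFn_smul a v, Lp.coeFn_smul b v']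
      with ω h1 h2 h3
    rw [h1, Pi.add_apply, h2, h3, Pi.smul_apply, Pi.smul_apply]
  refine ⟨hP.C₁_convex h1 h1' ha.le hb.le hab, ?_, ?_, ?_⟩
  · filter_upwards [h2, h2', hy] with ω k k' ky
    change (a • y + b • y' : Lp X₂ ∞ μ) ω ∈ P.C₂
    rw [ky]
    exact hP.C₂_convex k k' ha.le hb.le hab
  · filter_upwards [h3, h3', hy, hu] with ω k k' ky ku
    change P.e (a • x + b • x') ((a • y + b • y' : Lp X₂ ∞ μ) ω) ω
      = (a • u + b • u' : Lp W ∞ μ) ω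
    have hadd := (hP.e_linear ω).map_add (a • (x, y ω)) (b • (x', y' ω))
    rw [(hP.e_linear ω).map_smul, (hP.e_linear ω).map_smul] at hadd
    simp only at k k' hadd
    rw [ky, ku, ← k, ← k']
    exact hadd
  · filter_upwards [h4, h4', hy, hv] with ω k k' ky kv
    change (a • v + b • v' : Lp R ∞ μ) ω
      - P.i (a • x + b • x') ((a • y + b • y' : Lp X₂ ∞ μ) ω) ω ∈ P.K
    obtain rfl : b = 1 - a := by linarith
    have hi := hP.i_convex ω (x, y ω) (x', y' ω) a ha (by linarith)
    rw [ky, kv]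
    have k1 := P.K.smul_mem k ha.le
    have k2 := P.K.smul_mem k' hb.le
    have := P.K.add_mem (P.K.add_mem k1 k2) hi
    convert! this using 1
    simp only [smul_sub]
    abel

/-- Convergence in L^∞ is pointwise almost everywhere, so continuity of e and i for each fixed ω
passes the constraints to the limit. -/
theorem isClosed_feasibleGraph (hP : P.StandingAssumption μ) : IsClosed (P.feasibleGraph μ) := by
  refine IsSeqClosed.isClosed fun p q hp hq => ?_
  have hx : Tendsto (fun n => (p n).1.1) atTop (𝓝 q.1.1) :=
    ((continuous_fst.comp continuous_fst).tendsto q).comp hq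
  have hy := ae_tendsto_of_tendsto_Lp_top
    (((continuous_snd.comp continuous_fst).tendsto q).comp hq)
  have hu := ae_tendsto_of_tendsto_Lp_top
    (((continuous_fst.comp continuous_snd).tendsto q).comp hq)
  have hv := ae_tendsto_of_tendsto_Lp_top
    (((continuous_snd.comp continuous_snd).tendsto q).comp hq)
  refine ⟨hP.C₁_closed.mem_of_tendsto hx (Eventually.of_forall fun n => (hp n).1), ?_, ?_, ?_⟩
  · filter_upwards [hy, ae_all_iff.2 fun n => (hp n).2.1] with ω h1 h2
    exact hP.C₂_closed.mem_of_tendsto h1 (Eventually.of_forall h2)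
  · filter_upwards [hy, hu, ae_all_iff.2 fun n => (hp n).2.2.1] with ω h1 h2 h3
    refine tendsto_nhds_unique (((hP.e_continuous ω).tendsto _).comp (hx.prodMk_nhds h1)) ?_
    exact h2.congr fun n => (h3 n).symm
  · filter_upwards [hy, hv, ae_all_iff.2 fun n => (hp n).2.2.2] with ω h1 h2 h3
    exact P.K.isClosed.mem_of_tendsto
      (h2.sub (((hP.i_continuous ω).tendsto _).comp (hx.prodMk_nhds h1))) (Eventually.of_forall h3)

omit [NormedAddCommGroup X₁] [NormedSpace ℝ X₁] [NormedSpace ℝ X₂] [NormedSpace ℝ W] in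
theorem mem_feasibleGraph_zero_iff {x : X₁ × Lp X₂ ∞ μ} :
    (x, 0) ∈ P.feasibleGraph μ ↔ x ∈ P.admissible μ := by
  have h0 := Lp.coeFn_zero W ∞ μ
  have h0' := Lp.coeFn_zero R ∞ μ
  refine and_congr_right fun _ => and_congr_right fun _ => and_congr ?_ ?_
  · refine eventually_congr ?_
    filter_upwards [h0] with ω h
    change _ = (0 : Lp W ∞ μ) ω ↔ _
    rw [h, Pi.zero_apply]
  · refine eventually_congr ?_
    filter_upwards [h0'] with ω h
    change (0 : Lp R ∞ μ) ω - _ ∈ _ ↔ _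
    rw [h, Pi.zero_apply, zero_sub]

omit [NormedAddCommGroup X₁] [NormedSpace ℝ X₁] [NormedSpace ℝ X₂] [NormedSpace ℝ W] in
theorem RelativelyCompleteRecourse.exists_mem_feasibleGraph
    (hrec : P.RelativelyCompleteRecourse μ) {x₁ : X₁} (hx₁ : x₁ ∈ P.C₁) :
    ∃ y : Lp X₂ ∞ μ, ((x₁, y), 0) ∈ P.feasibleGraph μ := by
  obtain ⟨y, h1, h2, h3⟩ := hrec hx₁
  exact ⟨y, mem_feasibleGraph_zero_iff.2 ⟨hx₁, h3, h1, h2⟩⟩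

omit [NormedAddCommGroup X₁] [NormedSpace ℝ X₁] [NormedSpace ℝ X₂] [NormedSpace ℝ W] in
theorem valueFunction_lt_top_iff {u : Lp W ∞ μ × Lp R ∞ μ} :
    P.valueFunction μ u < ⊤ ↔ ∃ x, (x, u) ∈ P.feasibleGraph μ := by
  rw [valueFunction, iInf_lt_iff]
  refine exists_congr fun x => ?_
  by_cases h : x ∈ P.perturbedAdmissible μ u
  · simp only [perturbation, if_pos h, EReal.coe_lt_top, true_iff]
    exact h
  · simp only [perturbation, if_neg h, lt_self_iff_false, false_iff]
    exact h

/-- Small perturbations are feasible with bounded second stage and bounded recourse. -/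
theorem exists_bounded_feasible [CompleteSpace X₁] [CompleteSpace X₂] [CompleteSpace W]
    [CompleteSpace R] (hP : P.StandingAssumption μ)
    (hrec : P.RelativelyCompleteRecourse μ) (hstrict : P.StrictlyFeasible μ) :
    ∃ M : ℝ, ∃ ε > 0, ∀ u : Lp W ∞ μ × Lp R ∞ μ, ‖u‖ < ε →
      ∃ z : (X₁ × Lp X₂ ∞ μ) × Lp X₂ ∞ μ, ‖z‖ ≤ M ∧ (z.1, u) ∈ P.feasibleGraph μ ∧
        ((z.1.1, z.2), 0) ∈ P.feasibleGraph μ := by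
  -- The extra L^∞ coordinate is a recourse for the same first stage: f forgets it, g keeps it in
  -- place of the second stage and sets u = 0. Relatively complete recourse ensures that the image
  -- in U still contains dom v.
  let f : ((X₁ × Lp X₂ ∞ μ) × Lp X₂ ∞ μ) × (Lp W ∞ μ × Lp R ∞ μ) →L[ℝ]
      (X₁ × Lp X₂ ∞ μ) × (Lp W ∞ μ × Lp R ∞ μ) :=
    (ContinuousLinearMap.fst ℝ _ _).prodMap (ContinuousLinearMap.id ℝ _)
  let g : ((X₁ × Lp X₂ ∞ μ) × Lp X₂ ∞ μ) × (Lp W ∞ μ × Lp R ∞ μ) →L[ℝ]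
      (X₁ × Lp X₂ ∞ μ) × (Lp W ∞ μ × Lp R ∞ μ) :=
    (((ContinuousLinearMap.fst ℝ _ _).prodMap (ContinuousLinearMap.id ℝ _)).comp
      (ContinuousLinearMap.fst ℝ _ _)).prod 0
  have hc := convex_feasibleGraph hP
  have hcl := isClosed_feasibleGraph hP
  refine exists_bounded_preimage_of_mem_interior
    (G := f ⁻¹' P.feasibleGraph μ ∩ g ⁻¹' P.feasibleGraph μ)
    ((hc.linear_preimage f.toLinearMap).inter (hc.linear_preimage g.toLinearMap))
    ((hcl.preimage f.continuous).inter (hcl.preimage g.continuous))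
    (interior_mono (fun u hu => ?_) hstrict)
  obtain ⟨x, hx⟩ := valueFunction_lt_top_iff.1 hu
  obtain ⟨y, hy⟩ := hrec.exists_mem_feasibleGraph hx.1
  exact ⟨((x, y), u), ⟨hx, hy⟩, rfl⟩

/-! ### Bounds on the objective and a multiplier in the dual of L^∞ -/

section Objective

variable [IsProbabilityMeasure μ]

/-- The first stage is fixed because only J₂ is known to be bounded on bounded sets. -/
theorem objective_le (hP : P.StandingAssumption μ) (x₁ : X₁) (M : ℝ) :
    ∃ c, ∀ y : Lp X₂ ∞ μ, ‖y‖ ≤ M → P.objective μ (x₁, y) ≤ c := by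
  obtain ⟨a, _, ha⟩ := hP.J₂_bound (max 1 (‖x₁‖ + M)) (by positivity)
  refine ⟨P.J₁ x₁ + a, fun y hy => ?_⟩
  have h := norm_integral_le_of_norm_le_const (μ := μ) (f := fun ω => P.J₂ x₁ (y ω)) (C := a) (by
    filter_upwards [Lp.ae_norm_le_norm y] with ω hω
    exact ha _ _ (le_max_of_le_right (by linarith)))
  rw [probReal_univ, mul_one] at h
  have := (le_abs_self _).trans h
  simpa [objective] using this

/-- The value function is bounded above near the origin. -/
theorem exists_objective_le [CompleteSpace X₁] [CompleteSpace X₂] [CompleteSpace W]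
    [CompleteSpace R] (hP : P.StandingAssumption μ)
    (hrec : P.RelativelyCompleteRecourse μ) (hstrict : P.StrictlyFeasible μ) :
    ∃ c : ℝ, ∃ ε > 0, ∀ u : Lp W ∞ μ × Lp R ∞ μ, ‖u‖ < ε →
      ∃ x, (x, u) ∈ P.feasibleGraph μ ∧ P.objective μ x ≤ c := by
  obtain ⟨M, ε, hε, hM⟩ := exists_bounded_feasible hP hrec hstrict
  by_contra! hcon
  -- The radius shrinks like 2^-(n+1) so that multiplication by 2^(n+1) stays within ε, while every
  -- point feasible for `u' n` costs more than n.
  choose u' hu' hu'' using fun n : ℕ => hcon n ((1 / 2) ^ (n + 1) * ε) (by positivity)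
  have hu : ∀ n : ℕ, ‖((2 : ℝ) ^ (n + 1)) • u' n‖ < ε := by
    intro n
    have h := hu' n
    rw [norm_smul, Real.norm_of_nonneg (by positivity)]
    rw [one_div, inv_pow, ← div_eq_inv_mul, lt_div_iff₀ (by positivity)] at h
    linarith
  choose z hz hzu hz0 using fun n => hM _ (hu n)
  have hzn : ∀ n, ‖(z n).1.1‖ ≤ M ∧ ‖(z n).1.2‖ ≤ M ∧ ‖(z n).2‖ ≤ M := fun n =>
    ⟨(norm_fst_le (z n).1).trans ((norm_fst_le (z n)).trans (hz n)),
      (norm_snd_le (z n).1).trans ((norm_fst_le (z n)).trans (hz n)),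
      (norm_snd_le (z n)).trans (hz n)⟩
  obtain ⟨x, hx⟩ := summable_geometric_smul_of_norm_le fun n => (hzn n).1
  obtain ⟨c, hc⟩ := objective_le (μ := μ) hP x M
  obtain ⟨n, hn⟩ := exists_nat_ge c
  -- Only the n-th term keeps its perturbed second stage; all others use their recourse. The series
  -- of first stages is unaffected, so c was fixed before n was chosen.
  let y : ℕ → Lp X₂ ∞ μ := fun k => if k = n then (z k).1.2 else (z k).2
  let v : ℕ → Lp W ∞ μ × Lp R ∞ μ := fun k => if k = n then ((2 : ℝ) ^ (n + 1)) • u' n else 0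
  have hyM : ∀ k, ‖y k‖ ≤ M := by
    intro k
    by_cases hk : k = n
    · simpa [y, hk] using (hzn n).2.1
    · simpa [y, hk] using (hzn k).2.2
  obtain ⟨w, hw⟩ := summable_geometric_smul_of_norm_le hyM
  have hv : HasSum (fun k => ((1 / 2 : ℝ) ^ (k + 1)) • v k) (u' n) := by
    have h1 : ((1 / 2 : ℝ) ^ (n + 1)) • v n = u' n := by
      simp only [v, if_true]
      rw [smul_smul, ← mul_pow]
      norm_num
    rw [← h1]
    exact hasSum_single n fun k hk => by simp [v, hk]
  have hmem := (convex_feasibleGraph hP).mem_of_hasSum_geometric (isClosed_feasibleGraph hP)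
    (p := fun k => (((z k).1.1, y k), v k)) (fun k => by
      by_cases hk : k = n
      · subst hk
        simpa [y, v] using hzu k
      · simpa [y, v, hk] using hz0 k) ((hx.prodMk hw).prodMk hv)
  have h1 := hu'' n _ hmem
  have h2 := hc w (norm_le_of_hasSum_geometric hyM hw)
  linarith

-- For fixed x₁, J₂ differs from the convex J by a constant, and a convex function bounded above
-- near one point is continuous. This gives measurability of the integrand.
omit [IsProbabilityMeasure μ] in
theorem continuous_J₂ (hP : P.StandingAssumption μ) (x₁ : X₁) : Continuous (P.J₂ x₁) := by
  have hconv : ConvexOn ℝ univ (P.J₂ x₁) := by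
    refine ⟨convex_univ, fun y _ y' _ a b ha hb hab => ?_⟩
    have h := hP.J_convex.2 (mem_univ (x₁, y)) (mem_univ (x₁, y')) ha hb hab
    have hx : a • x₁ + b • x₁ = x₁ := by rw [← add_smul, hab, one_smul]
    simp only [Prod.fst_add, Prod.smul_fst, Prod.snd_add, Prod.smul_snd, hx, smul_eq_mul] at h ⊢
    have : a * P.J₁ x₁ + b * P.J₁ x₁ = P.J₁ x₁ := by rw [← add_mul, hab, one_mul]
    linarith
  rw [← continuousOn_univ]
  refine ((hconv.continuousOn_tfae isOpen_univ univ_nonempty).out 3 1).1 ?_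
  obtain ⟨a, _, ha⟩ := hP.J₂_bound (‖x₁‖ + 1) (by positivity)
  refine ⟨0, mem_univ _, a, eventually_map.2 ?_⟩
  filter_upwards [Metric.ball_mem_nhds (0 : X₂) one_pos] with y hy
  rw [mem_ball_zero_iff] at hy
  exact (le_abs_self _).trans (ha _ _ (by linarith))

omit [IsProbabilityMeasure μ] in
theorem aestronglyMeasurable_J₂ (hP : P.StandingAssumption μ) (x₁ : X₁) (y : Lp X₂ ∞ μ) :
    AEStronglyMeasurable (fun ω => P.J₂ x₁ (y ω)) μ :=
  (continuous_J₂ hP x₁).comp_aestronglyMeasurable (Lp.aestronglyMeasurable y)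

theorem integrable_J₂ (hP : P.StandingAssumption μ) (x₁ : X₁) (y : Lp X₂ ∞ μ) :
    Integrable (fun ω => P.J₂ x₁ (y ω)) μ := by
  obtain ⟨a, _, ha⟩ := hP.J₂_bound (‖x₁‖ + ‖y‖ + 1) (by positivity)
  refine Integrable.of_bound (aestronglyMeasurable_J₂ hP x₁ y) a ?_
  filter_upwards [Lp.ae_norm_le_norm y] with ω hω
  exact ha _ _ (by linarith)

theorem convexOn_objective (hP : P.StandingAssumption μ) :
    ConvexOn ℝ univ (P.objective μ) := by
  have heq : ∀ x : X₁ × Lp X₂ ∞ μ,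
      P.objective μ x = ∫ ω, (P.J₁ x.1 + P.J₂ x.1 (x.2 ω)) ∂μ := by
    intro x
    rw [integral_add (integrable_const _) (integrable_J₂ hP _ _), integral_const, probReal_univ,
      one_smul, objective]
  have hint : ∀ x : X₁ × Lp X₂ ∞ μ, Integrable (fun ω => P.J₁ x.1 + P.J₂ x.1 (x.2 ω)) μ :=
    fun x => (integrable_const _).add (integrable_J₂ hP _ _)
  refine ⟨convex_univ, fun x _ x' _ a b ha hb hab => ?_⟩
  rw [heq, heq, heq, smul_eq_mul, smul_eq_mul, ← integral_const_mul, ← integral_const_mul,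
    ← integral_add ((hint x).const_mul a) ((hint x').const_mul b)]
  refine integral_mono_ae (hint _) (((hint x).const_mul a).add ((hint x').const_mul b)) ?_
  filter_upwards [Lp.coeFn_add (a • x.2) (b • x'.2), Lp.coeFn_smul a x.2, Lp.coeFn_smul b x'.2]
    with ω h1 h2 h3
  have h := hP.J_convex.2 (mem_univ (x.1, x.2 ω)) (mem_univ (x'.1, x'.2 ω)) ha hb hab
  have h4 : (a • x + b • x').2 ω = a • x.2 ω + b • x'.2 ω := by
    change (a • x.2 + b • x'.2 : Lp X₂ ∞ μ) ω = _
    rw [h1, Pi.add_apply, h2, h3, Pi.smul_apply, Pi.smul_apply]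
  simp only [h4]
  exact h

/-- A multiplier in the dual of `L^∞`. -/
theorem exists_multiplier [CompleteSpace X₁] [CompleteSpace X₂] [CompleteSpace W]
    [CompleteSpace R] (hP : P.StandingAssumption μ)
    (hrec : P.RelativelyCompleteRecourse μ) (hstrict : P.StrictlyFeasible μ) {m : ℝ}
    (hm : ∀ x, (x, 0) ∈ P.feasibleGraph μ → m ≤ P.objective μ x) :
    ∃ F : StrongDual ℝ (Lp W ∞ μ × Lp R ∞ μ), ∀ x u, (x, u) ∈ P.feasibleGraph μ →
      m ≤ P.objective μ x + F u := by
  obtain ⟨c, ε, hε, hc⟩ := exists_objective_le hP hrec hstrict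
  set A : Set ((Lp W ∞ μ × Lp R ∞ μ) × ℝ) :=
    {p | ∃ x, (x, p.1) ∈ P.feasibleGraph μ ∧ P.objective μ x ≤ p.2} with hA
  have hAc : Convex ℝ A := by
    rintro ⟨u, r⟩ ⟨x, hx, hxr⟩ ⟨u', r'⟩ ⟨x', hx', hxr'⟩ a b ha hb hab
    refine ⟨a • x + b • x', convex_feasibleGraph hP hx hx' ha hb hab, ?_⟩
    refine ((convexOn_objective hP).2 (mem_univ x) (mem_univ x') ha hb hab).trans ?_
    change a • P.objective μ x + b • P.objective μ x' ≤ a • r + b • r'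
    simp only at hxr hxr'
    gcongr
  have hsub : Metric.ball (0 : Lp W ∞ μ × Lp R ∞ μ) ε ×ˢ Ioi c ⊆ A := by
    rintro ⟨u, r⟩ ⟨hu, hr⟩
    obtain ⟨x, hx, hxc⟩ := hc u (by simpa using hu)
    exact ⟨x, hx, hxc.trans (le_of_lt hr)⟩
  have hint : Metric.ball (0 : Lp W ∞ μ × Lp R ∞ μ) ε ×ˢ Ioi c ⊆ interior A :=
    interior_maximal hsub (Metric.isOpen_ball.prod isOpen_Ioi)
  have hnot : ((0 : Lp W ∞ μ × Lp R ∞ μ), m) ∉ interior A := by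
    intro h
    have hcont : Continuous fun r : ℝ => ((0 : Lp W ∞ μ × Lp R ∞ μ), r) := by fun_prop
    have hnhds := (isOpen_interior.preimage hcont).mem_nhds h
    obtain ⟨δ, hδ, hball⟩ := Metric.mem_nhds_iff.1 hnhds
    have hmem : m - δ / 2 ∈ Metric.ball m δ := by
      rw [Metric.mem_ball, Real.dist_eq, abs_lt]
      constructor <;> linarith
    obtain ⟨x, hx, hxr⟩ := interior_subset (hball hmem)
    have := hm x hx
    simp only at hxr
    linarith
  obtain ⟨f, hf⟩ := geometric_hahn_banach_open_point hAc.interior isOpen_interior hnot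
  set F₀ : StrongDual ℝ (Lp W ∞ μ × Lp R ∞ μ) := f.comp (ContinuousLinearMap.inl ℝ _ ℝ)
  set α : ℝ := f (0, 1) with hα
  have hfe : ∀ u r, f (u, r) = F₀ u + r * α := by
    intro u r
    have : ((u, r) : (Lp W ∞ μ × Lp R ∞ μ) × ℝ) = (u, 0) + r • (0, 1) := by simp
    rw [this, map_add, map_smul]
    rfl
  -- Separation holds on the interior; it extends to `A` since a convex set with nonempty interior
  -- lies in the closure of that interior.
  have hle : ∀ p ∈ A, f p ≤ f (0, m) := by
    intro p hp
    have hne : (interior A).Nonempty :=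
      ⟨(0, c + 1), hint ⟨Metric.mem_ball_self hε, by simp⟩⟩
    have hcl := hAc.closure_interior_eq_closure_of_nonempty_interior hne
    have hp' : p ∈ closure (interior A) := hcl ▸ subset_closure hp
    exact closure_minimal (fun q hq => (hf q hq).le)
      (isClosed_le f.continuous continuous_const) hp'
  -- An interior point vertically above (0, m) rules out a vertical hyperplane and fixes the sign;
  -- dividing by α then reverses the inequality.
  have hneg : α < 0 := by
    have hcm : c < max c m + 1 := by linarith [le_max_left c m]
    have := hf (0, max c m + 1) (hint ⟨Metric.mem_ball_self hε, hcm⟩)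
    rw [hfe, hfe] at this
    have h2 := le_max_right c m
    by_contra! h
    nlinarith
  refine ⟨α⁻¹ • F₀, fun x u hxu => ?_⟩
  have h := hle (u, P.objective μ x) ⟨x, hxu, le_rfl⟩
  rw [hfe, hfe, map_zero, zero_add] at h
  have h3 : (α⁻¹ • F₀) u = F₀ u / α := by
    rw [_root_.smul_apply, smul_eq_mul, div_eq_inv_mul]
  rw [h3, ← sub_le_iff_le_add', le_div_iff_of_neg hneg]
  linarith

end Objective

/-! ### Weak duality and removal of the singular part -/

omit [NormedAddCommGroup X₁] [NormedSpace ℝ X₁] [NormedSpace ℝ X₂] [NormedSpace ℝ W] in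
-- The second-stage constraints are pointwise in ω, so two second stages over the same x₁ can be
-- glued along any measurable set.
theorem lpCut_mem_feasibleGraph {x₁ : X₁} {x₂ y : Lp X₂ ∞ μ} {u : Lp W ∞ μ × Lp R ∞ μ}
    (hx : ((x₁, x₂), u) ∈ P.feasibleGraph μ) (hy : ((x₁, y), 0) ∈ P.feasibleGraph μ)
    {B : Set Ω} (hB : MeasurableSet B) :
    ((x₁, lpCut B hB x₂ + lpCut Bᶜ hB.compl y), (lpCut B hB u.1, lpCut B hB u.2)) ∈
      P.feasibleGraph μ := by
  obtain ⟨h1, h2, h3, h4⟩ := hx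
  obtain ⟨_, k2, k3, k4⟩ := mem_feasibleGraph_zero_iff.1 hy
  obtain ⟨z, hz⟩ : ∃ z, z = lpCut B hB x₂ + lpCut Bᶜ hB.compl y := ⟨_, rfl⟩
  rw [← hz]
  replace hz : ∀ᵐ ω ∂μ, z ω = B.indicator x₂ ω + Bᶜ.indicator y ω := by
    rw [hz]
    filter_upwards [Lp.coeFn_add (lpCut B hB x₂) (lpCut Bᶜ hB.compl y), coeFn_lpCut B hB x₂,
      coeFn_lpCut Bᶜ hB.compl y] with ω h1 h2 h3
    rw [h1, Pi.add_apply, h2, h3]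
  refine ⟨h1, ?_, ?_, ?_⟩
  · filter_upwards [h2, k2, hz] with ω h k hz
    by_cases hω : ω ∈ B
    · simpa [hz, hω] using h
    · simpa [hz, hω] using k
  · filter_upwards [h3, k3, hz, coeFn_lpCut B hB u.1] with ω h k hz hu
    by_cases hω : ω ∈ B
    · simpa [hz, hu, hω] using h
    · simpa [hz, hu, hω] using k
  · filter_upwards [h4, k4, hz, coeFn_lpCut B hB u.2] with ω h k hz hu
    by_cases hω : ω ∈ B
    · simpa [hz, hu, hω] using h
    · simpa [hz, hu, hω] using k

omit [NormedAddCommGroup X₁] [NormedSpace ℝ X₁] [NormedSpace ℝ X₂] in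
/-- Weak duality. -/
theorem dualObjective_le_infPrimal
    (l : Lp (StrongDual ℝ W) 1 μ × Lp (StrongDual ℝ R) 1 μ) :
    P.dualObjective μ l ≤ P.infPrimal μ := by
  refine le_iInf₂ fun x hx => iInf_le_of_le x (iInf_le_of_le 0 ?_)
  have h0 : pairing μ (0 : Lp W ∞ μ × Lp R ∞ μ) l = 0 := by
    refine integral_eq_zero_of_ae ?_
    filter_upwards [Lp.coeFn_zero W ∞ μ, Lp.coeFn_zero R ∞ μ] with ω h1 h2
    change l.1 ω ((0 : Lp W ∞ μ) ω) + l.2 ω ((0 : Lp R ∞ μ) ω) = 0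
    rw [h1, h2]
    simp
  have hx' : x ∈ P.perturbedAdmissible μ 0 := mem_feasibleGraph_zero_iff.2 hx
  rw [h0, perturbation, if_pos hx', EReal.coe_zero, zero_add]

omit [NormedAddCommGroup X₁] [NormedSpace ℝ X₁] [NormedSpace ℝ X₂] in
theorem le_dualObjective {m : ℝ} {l : Lp (StrongDual ℝ W) 1 μ × Lp (StrongDual ℝ R) 1 μ}
    (h : ∀ x u, (x, u) ∈ P.feasibleGraph μ → m ≤ P.objective μ x + pairing μ u l) :
    (m : EReal) ≤ P.dualObjective μ l := by
  refine le_iInf fun x => le_iInf fun u => ?_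
  by_cases hx : x ∈ P.perturbedAdmissible μ u
  · rw [perturbation, if_pos hx, ← EReal.coe_add, add_comm]
    exact EReal.coe_le_coe_iff.2 (h x u hx)
  · rw [perturbation, if_neg hx, EReal.coe_add_top]
    exact le_top

variable [IsProbabilityMeasure μ]

/-- Relatively complete recourse allows one to drop the singular part of a multiplier. -/
theorem exists_integrable_multiplier [TopologicalSpace.SeparableSpace W]
    [TopologicalSpace.SeparableSpace R] [TopologicalSpace.SeparableSpace (StrongDual ℝ W)]
    [TopologicalSpace.SeparableSpace (StrongDual ℝ R)]
    (hP : P.StandingAssumption μ) (hrec : P.RelativelyCompleteRecourse μ) {m : ℝ}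
    {F : StrongDual ℝ (Lp W ∞ μ × Lp R ∞ μ)}
    (hF : ∀ x u, (x, u) ∈ P.feasibleGraph μ → m ≤ P.objective μ x + F u) :
    ∃ l : Lp (StrongDual ℝ W) 1 μ × Lp (StrongDual ℝ R) 1 μ,
      ∀ x u, (x, u) ∈ P.feasibleGraph μ → m ≤ P.objective μ x + pairing μ u l := by
  obtain ⟨l, E, hEm, hE, hEae, hl⟩ :=
    exists_integrable_density (F.comp (ContinuousLinearMap.inl ℝ (Lp W ∞ μ) (Lp R ∞ μ)))
  obtain ⟨l', E', hEm', hE', hEae', hl'⟩ :=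
    exists_integrable_density (F.comp (ContinuousLinearMap.inr ℝ (Lp W ∞ μ) (Lp R ∞ μ)))
  have hli : Integrable l μ := memLp_one_iff_integrable.1 (Lp.memLp l)
  have hli' : Integrable l' μ := memLp_one_iff_integrable.1 (Lp.memLp l')
  refine ⟨(l, l'), fun ⟨x₁, x₂⟩ u hxu => ?_⟩
  obtain ⟨y, hy⟩ := hrec.exists_mem_feasibleGraph hxu.1
  set B : ℕ → Set Ω := fun n => E n ∩ E' n
  have hB : ∀ n, MeasurableSet (B n) := fun n => (hEm n).inter (hEm' n)
  have hBae : ∀ᵐ ω ∂μ, ∀ᶠ n in atTop, ω ∈ B n := by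
    filter_upwards [hEae, hEae'] with ω ⟨n, hn⟩ ⟨n', hn'⟩
    filter_upwards [eventually_ge_atTop n, eventually_ge_atTop n'] with k hk hk'
    exact ⟨hE hk hn, hE' hk' hn'⟩
  set z : ℕ → Lp X₂ ∞ μ := fun n => lpCut (B n) (hB n) x₂ + lpCut (B n)ᶜ (hB n).compl y
  set v : ℕ → Lp W ∞ μ := fun n => lpCut (B n) (hB n) u.1
  set w : ℕ → Lp R ∞ μ := fun n => lpCut (B n) (hB n) u.2
  set f : ℕ → Ω → ℝ := fun n ω => P.J₂ x₁ (z n ω) + (l ω (v n ω) + l' ω (w n ω))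
  set g : Ω → ℝ := fun ω => P.J₂ x₁ (x₂ ω) + (l ω (u.1 ω) + l' ω (u.2 ω))
  have hpair : ∀ (a : Lp W ∞ μ) (b : Lp R ∞ μ),
      Integrable (fun ω => l ω (a ω) + l' ω (b ω)) μ := fun a b =>
    (integrable_dual_apply hli a).add (integrable_dual_apply hli' b)
  -- The glued point has a perturbation supported in both `E n` and `E' n`, where F acts through its
  -- densities.
  have hmn : ∀ n, m ≤ P.J₁ x₁ + ∫ ω, f n ω ∂μ := by
    intro n
    have h := hF _ _ (lpCut_mem_feasibleGraph hxu hy (hB n))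
    have h1 : F (v n, w n) = ∫ ω, (l ω (v n ω) + l' ω (w n ω)) ∂μ := by
      rw [integral_add (integrable_dual_apply hli _) (integrable_dual_apply hli' _),
        ← hl n (v n), ← hl' n (w n)]
      · simp [← map_add]
      · filter_upwards [lpCut_eq_zero_of_notMem (B n) (hB n) u.2] with ω h h'
        exact h fun h'' => h' h''.2
      · filter_upwards [lpCut_eq_zero_of_notMem (B n) (hB n) u.1] with ω h h'
        exact h fun h'' => h' h''.1
    rw [integral_add (integrable_J₂ hP _ _) (hpair _ _), ← h1, ← add_assoc]
    exact h
  have hz : ∀ n, ∀ᵐ ω ∂μ, z n ω = (B n).indicator x₂ ω + (B n)ᶜ.indicator y ω := by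
    intro n
    filter_upwards [Lp.coeFn_add (lpCut (B n) (hB n) x₂) (lpCut (B n)ᶜ (hB n).compl y),
      coeFn_lpCut (B n) (hB n) x₂, coeFn_lpCut (B n)ᶜ (hB n).compl y] with ω h1 h2 h3
    rw [h1, Pi.add_apply, h2, h3]
  obtain ⟨a, _, ha⟩ := hP.J₂_bound (‖x₁‖ + (‖x₂‖ + ‖y‖) + 1) (by positivity)
  have hlim : Tendsto (fun n => ∫ ω, f n ω ∂μ) atTop (𝓝 (∫ ω, g ω ∂μ)) := by
    refine tendsto_integral_of_dominated_convergence
      (fun ω => a + (‖l ω‖ * ‖u.1‖ + ‖l' ω‖ * ‖u.2‖))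
      (fun n => (integrable_J₂ hP _ _).1.add (hpair _ _).1)
      ((integrable_const _).add ((hli.norm.mul_const _).add (hli'.norm.mul_const _))) ?_ ?_
    · intro n
      filter_upwards [Lp.ae_norm_le_norm (z n), Lp.ae_norm_le_norm (v n),
        Lp.ae_norm_le_norm (w n)] with ω h1 h2 h3
      have hzn : ‖z n‖ ≤ ‖x₂‖ + ‖y‖ :=
        (norm_add_le _ _).trans (add_le_add (norm_lpCut_le _ _ _) (norm_lpCut_le _ _ _))
      refine (norm_add_le _ _).trans (add_le_add (ha _ _ (by linarith))
        ((norm_add_le _ _).trans (add_le_add ?_ ?_)))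
      · exact (l ω).le_opNorm_of_le (h2.trans (norm_lpCut_le _ _ _))
      · exact (l' ω).le_opNorm_of_le (h3.trans (norm_lpCut_le _ _ _))
    · filter_upwards [hBae, ae_all_iff.2 hz, ae_all_iff.2 fun n => coeFn_lpCut (B n) (hB n) u.1,
        ae_all_iff.2 fun n => coeFn_lpCut (B n) (hB n) u.2] with ω h1 h2 h3 h4
      -- Almost every ω lies eventually in `B n`, so the integrands are eventually constant in n.
      refine tendsto_const_nhds.congr' ?_
      filter_upwards [h1] with n hn
      simp only [f, g, h2 n]
      rw [h3 n, h4 n]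
      simp [hn]
  have h := ge_of_tendsto' (tendsto_const_nhds.add hlim) hmn
  rw [integral_add (integrable_J₂ hP _ _) (hpair _ _), ← add_assoc] at h
  exact h

end TwoStageProblem

end

/-! ### The duality theorem -/

theorem mainTheorem2 {Ω X₁ X₂ W R : Type*} [MeasurableSpace Ω]
    [NormedAddCommGroup X₁] [NormedSpace ℝ X₁] [CompleteSpace X₁]
    [TopologicalSpace.SeparableSpace X₁]
    [NormedAddCommGroup X₂] [NormedSpace ℝ X₂] [CompleteSpace X₂]
    [TopologicalSpace.SeparableSpace X₂]
    [NormedAddCommGroup W] [NormedSpace ℝ W] [CompleteSpace W]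
    [TopologicalSpace.SeparableSpace W]
    [NormedAddCommGroup R] [NormedSpace ℝ R] [CompleteSpace R]
    [TopologicalSpace.SeparableSpace R]
    (hX₁ : Function.Surjective (NormedSpace.inclusionInDoubleDual ℝ X₁))
    (hX₂ : Function.Surjective (NormedSpace.inclusionInDoubleDual ℝ X₂))
    (hW : Function.Surjective (NormedSpace.inclusionInDoubleDual ℝ W))
    (hR : Function.Surjective (NormedSpace.inclusionInDoubleDual ℝ R))
    (μ : Measure Ω) [IsProbabilityMeasure μ] [μ.IsComplete]
    (P : TwoStageProblem Ω X₁ X₂ W R)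
    (hP : P.StandingAssumption μ)
    (hrec : P.RelativelyCompleteRecourse μ)
    (hstrict : P.StrictlyFeasible μ) :
    P.infPrimal μ < ⊤ ∧
      ∃ l : Lp (StrongDual ℝ W) 1 μ × Lp (StrongDual ℝ R) 1 μ,
        P.dualObjective μ l = P.infPrimal μ ∧
          ∀ l' : Lp (StrongDual ℝ W) 1 μ × Lp (StrongDual ℝ R) 1 μ,
            P.dualObjective μ l' ≤ P.dualObjective μ l := by
  have hlt : P.infPrimal μ < ⊤ := by
    have h0 : P.valueFunction μ 0 < ⊤ :=
      interior_subset (s := {u | P.valueFunction μ u < ⊤}) hstrict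
    obtain ⟨x, hx⟩ := TwoStageProblem.valueFunction_lt_top_iff.1 h0
    exact (iInf₂_le x (TwoStageProblem.mem_feasibleGraph_zero_iff.1 hx)).trans_lt
      (EReal.coe_lt_top _)
  refine ⟨hlt, ?_⟩
  suffices h : ∃ l : Lp (StrongDual ℝ W) 1 μ × Lp (StrongDual ℝ R) 1 μ,
      P.infPrimal μ ≤ P.dualObjective μ l by
    obtain ⟨l, hl⟩ := h
    have heq := le_antisymm (TwoStageProblem.dualObjective_le_infPrimal l) hl
    exact ⟨l, heq, fun l' => heq ▸ TwoStageProblem.dualObjective_le_infPrimal l'⟩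
  -- If the primal value is -∞, weak duality makes every multiplier optimal.
  rcases eq_or_ne (P.infPrimal μ) ⊥ with hbot | hbot
  · exact ⟨0, hbot ▸ bot_le⟩
  -- Reflexivity of W and R enters here, through the separable duals needed for the densities.
  have := separableSpace_dual_of_surjective_inclusionInDoubleDual hW
  have := separableSpace_dual_of_surjective_inclusionInDoubleDual hR
  lift P.infPrimal μ to ℝ using ⟨hlt.ne, hbot⟩ with m hm
  obtain ⟨F, hF⟩ := TwoStageProblem.exists_multiplier hP hrec hstrict (m := m) fun x hx => by
    rw [← EReal.coe_le_coe_iff, hm]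
    exact iInf₂_le x (TwoStageProblem.mem_feasibleGraph_zero_iff.1 hx)
  obtain ⟨l, hl⟩ := TwoStageProblem.exists_integrable_multiplier hP hrec hF
  exact ⟨l, TwoStageProblem.le_dualObjective hl⟩
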